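/- **Setting.** Languages are first-order with finitely many symbols; $\underline P(M)$ is the set of all subsets of the universe $|M|$; models may be empty. $\bar k$ denotes a finite sequence of natural numbers with all entries $\ge 1$, and $\bar k(i)=1$ for $i\ge \ell(\bar k)$. Call $\bar k$ *admissible* for a language $L$ if moreover $\bar k(0)\ge$ the number of places of every predicate of $L$. Let $\Phi$ be a finite set of first-order formulas $\varphi(X_1,\dots;x_1,\dots)$ of $L$ with free set variables $X_j$. For an $L$-model $M$, a finite sequence $\bar P$ of subsets of $|M|$ and a finite sequence $\bar a$ from $|M|$ put $$th^0_{\bar k}((M,\bar P,\bar a),\Phi)=\{\varphi(X_{\ell_1},\dots;x_{j_1},\dots):\varphi\in\Phi,\ M\models\varphi[P_{\ell_1},\dots;a_{j_1},\dots]\},$$ $$th^{n+1}_{\bar k}((M,\bar P,\bar a),\Phi)=\{th^n_{\bar k}((M,\bar P,\bar a^\frown\bar b),\Phi):\bar b\in|M|^{\bar k(n)}\},$$ $$Th^0_{\bar k}((M,\bar P),\Phi)=th^1_{\bar k}((M,\bar P),\Phi),\qquad Th^{n+1}_{\bar k}((M,\bar P),\Phi)=\{Th^n_{\bar k}((M,\bar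 P^\frown\bar Q),\Phi):\bar Q\in\underline P(M)^{\bar k(n+1)}\}.$$ These are hereditarily finite sets. The *formally possible* values are given by the same recursion with "any set of formal instances" and "any set of formally possible values" in place of the sets above; they form a finite set, listed in a fixed order. For a relational language, $\Phi$ is omitted when it is the set of atomic formulas ($R(\bar x)$, $x=y$, $x\in X$). An *$n$-condition* $\tau=\langle E,\Phi,\Psi\rangle$ for $(L_1,L_2)$ consists of an equivalence relation $E$ on $\{0,\dots,n-1\}$, a finite set $\Phi$ of formulas $\varphi(x_{j_1},\dots,x_{j_q})$ of $L_1$ with $q\ge1$ and $j_1,\dots,j_q<n$ pairwise $E$-equivalent, and a finite set $\Psi$ of formulas $\psi(x_{j_1},\dots,x_{j_q})$ of $L_2$ with $j_1,\dots,j_q<n$. A *rule* is $\sigma=\langle L_1,L_2,L_3,\sigma^*\rangle$, where $L_3$ is relational and $\sigma^*(R)$ is a finite set of $n$-conditions for every $n$-place predicate $R$ of $L_3$. Let $N$ be an $L_2$-model and $M_i$ ($i\in|N|$) $L_1$-models with pairwise disjoint universes. A sequence $a_0,\dots,a_{n-1}$ with $a_\ell\in|M_{i(\ell)}|$ satisfies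 $\tau$ if $i(\ell)=i(\ell')\Leftrightarrow \ell E\ell'$, $M_{i(j_1)}\models\varphi[a_{j_1},\dots]$ for every $\varphi(x_{j_1},\dots)\in\Phi$, and $N\models\psi[i(j_1),\dots]$ for every $\psi(x_{j_1},\dots)\in\Psi$. The *generalized sum* $\sum^\sigma_{i\in N}M_i$ is the $L_3$-model with universe $\bigcup_i|M_i|$ in which $R(\bar a)$ holds iff $\bar a$ satisfies some $\tau\in\sigma^*(R)$. Let $\Phi(\sigma)$ (respectively $\Psi(\sigma)$) be the set of all $L_1$-formulas (respectively $L_2$-formulas) appearing in $\sigma$, together with $x=y$ and $x\in X$. **Theorem 2.4.** There are a computable function $(\sigma,n,m,\bar k)\mapsto\bar r$ and a computable function $F$ such that for every rule $\sigma$, all $n,m$ and every $\bar k$ admissible for $L_3$, the sequence $\bar r$ is admissible for $L_2$, has length $\ge n+1$, and the following holds. For every $L_2$-model $N$, all $L_1$-models $M_i$ and all $\bar P_i\in\underline P(M_i)^m$ ($i\in|N|$), let $t_i=Th^n_{\bar k}((M_i,\bar P_i),\Phi(\sigma))$ and $Q_t=\{i\in |N|:t_i=t\}$ for each formally possible $t$.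 Then $$Th^n_{\bar k}\Big(\sum^\sigma_{i\in N}M_i,\ \bigcup_i\bar P_i\Big)=F\Big(\sigma,n,m,\bar k,\ Th^n_{\bar r}\big((N,\dots,Q_t,\dots),\Psi(\sigma)\big)\Big),$$ where $\bigcup_i\bar P_i$ is the coordinatewise union. In particular (Corollary 2.8), for ordered sums of linear orders: there are computable functions $(n,m,\bar k)\mapsto\bar r$ and $G$ such that for all $n,m$ and every $\bar k$ admissible for $\{<\}$, $\bar r$ is admissible for $\{<\}$, has length $\ge n+1$, and for every linear order $N$, all linear orders $M_i$ and all $\bar P_i\in\underline P(M_i)^m$ ($i\in N$), with $t_i=Th^n_{\bar k}(M_i,\bar P_i)$ and $P_t=\{i\in N:t_i=t\}$ for each formally possible $t$, $$Th^n_{\bar k}\Big(\sum_{i\in N}M_i,\ \bigcup_i\bar P_i\Big)=G\big(n,m,\bar k,\ Th^n_{\bar r}(N,\dots,P_t,\dots)\big).$$ -/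

import Mathlib

universe u v

namespace MonadicSum

/-! ### Finite languages, formulas with set variables, Gödel numbers -/

/-- A first-order language with finitely many symbols, presented by the lists of the arities
of its function symbols and of its predicates. -/
structure FinLang where
  fns : List ℕ
  rels : List ℕ

/-- The Mathlib language presented by `L`. -/
def FinLang.lang (L : FinLang) : FirstOrder.Language.{0, 0} where
  Functions n := {i : Fin L.fns.length // L.fns.get i = n}
  Relations n := {i : Fin L.rels.length // L.rels.get i = n}

/-- The finite language with predicates of arities `A` and without function symbols. -/
abbrev relLang (A : List ℕ) : FinLang := ⟨[], A⟩

/-- The language of the set variables `X_0, …, X_{p-1}`: `p` one-place predicates. -/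
def setLang (p : ℕ) : FirstOrder.Language.{0, 0} where
  Functions _ := Empty
  Relations n := {_j : Fin p // n = 1}

/-- The language `L` together with the set variables `X_0, …, X_{p-1}`. -/
abbrev FinLang.withSets (L : FinLang) (p : ℕ) : FirstOrder.Language.{0, 0} := L.lang.sum (setLang p)

/-- `X_j` is interpreted as the set `P j`. -/
@[reducible] def setStructure {M : Type u} {p : ℕ} (P : Fin p → Set M) : (setLang p).Structure M where
  funMap f _ := f.elim
  RelMap R x := x (Fin.cast R.2.symm 0) ∈ P R.1

/-- A first-order formula `φ(X_0, …, X_{p-1}; x_0, …, x_{q-1})` of `L` with free set variables. -/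
structure Fml (L : FinLang) where
  p : ℕ
  q : ℕ
  form : (L.withSets p).Formula (Fin q)

/-- `M ⊨ φ[P, a]`. -/
def Fml.Holds {L : FinLang} (φ : Fml L) {M : Type u} [L.lang.Structure M]
    (P : Fin φ.p → Set M) (a : Fin φ.q → M) : Prop :=
  letI := setStructure P
  φ.form.Realize a

/-- Gödel number of a term, relative to a numbering of the function symbols. -/
def termCode {L : FirstOrder.Language.{0, 0}} (cf : ∀ n, L.Functions n → ℕ) {q n : ℕ} :
    L.Term (Fin q ⊕ Fin n) → ℕ
  | .var (.inl i) => Nat.pair 0 i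
  | .var (.inr i) => Nat.pair 1 i
  | .func f ts =>
      Nat.pair 2 (Nat.pair (cf _ f) (Encodable.encode (List.ofFn fun i => termCode cf (ts i))))

/-- Gödel number of a formula, relative to a numbering of the symbols. -/
def formulaCode {L : FirstOrder.Language.{0, 0}} (cf : ∀ n, L.Functions n → ℕ)
    (cr : ∀ n, L.Relations n → ℕ) {q : ℕ} : {n : ℕ} → L.BoundedFormula (Fin q) n → ℕ
  | _, .falsum => Nat.pair 0 0
  | _, .equal t s => Nat.pair 1 (Nat.pair (termCode cf t) (termCode cf s))
  | _, .rel R ts =>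
      Nat.pair 2 (Nat.pair (cr _ R) (Encodable.encode (List.ofFn fun i => termCode cf (ts i))))
  | _, .imp φ ψ => Nat.pair 3 (Nat.pair (formulaCode cf cr φ) (formulaCode cf cr ψ))
  | _, .all φ => Nat.pair 4 (formulaCode cf cr φ)

/-- The numbering of the symbols of `L` and of the set variables: the `i`-th function symbol gets
`i`, the `i`-th predicate `2 i`, the set variable `X_j` gets `2 j + 1`. -/
def FinLang.funCode (L : FinLang) (n : ℕ) (f : L.lang.Functions n) : ℕ := f.1

/-- See `FinLang.funCode`. -/
def FinLang.relCode (L : FinLang) (n : ℕ) (R : L.lang.Relations n) : ℕ := 2 * (R.1 : ℕ)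

/-- See `FinLang.funCode`. -/
def FinLang.setsFunCode (L : FinLang) (p n : ℕ) : (L.withSets p).Functions n → ℕ
  | .inl f => L.funCode n f
  | .inr e => Empty.elim e

/-- See `FinLang.funCode`. -/
def FinLang.setsRelCode (L : FinLang) (p n : ℕ) : (L.withSets p).Relations n → ℕ
  | .inl R => L.relCode n R
  | .inr X => 2 * (X.1 : ℕ) + 1

/-- Gödel number of a formula of `L` without set variables. -/
def FinLang.code (L : FinLang) {q : ℕ} (φ : L.lang.Formula (Fin q)) : ℕ :=
  formulaCode L.funCode L.relCode φ

/-- Gödel number of a formula with set variables; it contains the numbers of its variables. -/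
def Fml.code {L : FinLang} (φ : Fml L) : ℕ :=
  Encodable.encode (φ.p, φ.q, formulaCode (L.setsFunCode φ.p) (L.setsRelCode φ.p) φ.form)

/-- A first-order formula without set variables, as a formula with set variables. -/
def ofFormula {L : FinLang} {q : ℕ} (φ : L.lang.Formula (Fin q)) : Fml L :=
  ⟨0, q, FirstOrder.Language.LHom.sumInl.onFormula φ⟩

/-- The formula `x_0 = x_1`. -/
def eqFml (L : FinLang) : Fml L :=
  ofFormula ((FirstOrder.Language.var 0 : L.lang.Term (Fin 2)).equal (FirstOrder.Language.var 1))

/-- The formula `X_0(x_0)`, that is, `x_0 ∈ X_0`. -/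
def memFml (L : FinLang) : Fml L :=
  ⟨1, 1, FirstOrder.Language.Relations.formula₁ (L := L.withSets 1) (Sum.inr ⟨0, rfl⟩)
    (FirstOrder.Language.var 0)⟩

/-- The atomic formulas of a finite relational language (the instances `R(x_{j_1}, …)` of
`R(x_0, …)` come in when the theories are defined): `R(x_0, x_1, …)` for every predicate `R`,
`x_0 = x_1`, and `x_0 ∈ X_0`. -/
noncomputable def atomic (A : List ℕ) : Finset (Fml (relLang A)) :=
  open Classical in
  (Finset.univ.image fun i : Fin A.length =>
    (ofFormula (FirstOrder.Language.Relations.formula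
      (L := (relLang A).lang) (n := A.get i) ⟨i, rfl⟩
      fun j : Fin (A.get i) => FirstOrder.Language.var j) : Fml (relLang A)))
  ∪ {eqFml _, memFml _}

/-! ### Hereditarily finite sets and the theories `th`, `Th` -/

/-- The natural number coding the finite set `S` of (codes of) objects: `∑_{a ∈ S} 2 ^ a`.
(Only used for finite sets.) -/
noncomputable def hf (S : Set ℕ) : ℕ := ∑ᶠ a ∈ S, 2 ^ a

/-- The value `k̄(i)` of a finite sequence, understood to be `1` beyond the length of `k̄`. -/
def seq (k : List ℕ) (i : ℕ) : ℕ := k.getD i 1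

/-- The standing convention on the sequences `k̄`: `k̄(i) ≥ 1`, and `k̄(0)` is at least the
number of places of every predicate. -/
def Admissible (L : FinLang) (k : List ℕ) : Prop :=
  (∀ x ∈ k, 1 ≤ x) ∧ ∀ a ∈ L.rels, a ≤ seq k 0

/-- The code of the formal instance `φ(X_{l_1}, …; x_{j_1}, …)` of `φ(X_1, …; x_1, …)`. -/
def instCode {L : FinLang} (φ : Fml L) {p q : ℕ} (l : Fin φ.p → Fin p) (j : Fin φ.q → Fin q) : ℕ :=
  Encodable.encode (φ.code, List.ofFn (fun s => (l s : ℕ)), List.ofFn (fun s => (j s : ℕ)))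

section
variable {L : FinLang} {M : Type u} [L.lang.Structure M]

/-- `th^n_k̄((M, P̄, ā), Φ)`, coded as a natural number. -/
noncomputable def th (Φ : Finset (Fml L)) (k : List ℕ) (P : List (Set M)) : ℕ → List M → ℕ
  | 0, a => hf {c | ∃ φ ∈ Φ, ∃ (l : Fin φ.p → Fin P.length) (j : Fin φ.q → Fin a.length),
      φ.Holds (fun s => P.get (l s)) (fun s => a.get (j s)) ∧ c = instCode φ l j}
  | n + 1, a => hf {c | ∃ b : List M, b.length = seq k n ∧ c = th Φ k P n (a ++ b)}

/-- `Th^n_k̄((M, P̄), Φ)`, coded as a natural number. -/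
noncomputable def Th (Φ : Finset (Fml L)) (k : List ℕ) : ℕ → List (Set M) → ℕ
  | 0, P => th Φ k P 1 []
  | n + 1, P => hf {c | ∃ Q : List (Set M), Q.length = seq k (n + 1) ∧ c = Th Φ k n (P ++ Q)}

end

/-- The codes of all subsets of a finite set of codes. -/
noncomputable def powCodes (A : Finset ℕ) : Finset ℕ :=
  A.powerset.image fun s => ∑ a ∈ s, 2 ^ a

/-- The codes of all formal instances of formulas from `Φ` with `p` sets and `q` elements. -/
noncomputable def instCodes {L : FinLang} (Φ : Finset (Fml L)) (p q : ℕ) : Finset ℕ :=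
  Φ.biUnion fun φ => Finset.univ.image
    fun lj : (Fin φ.p → Fin p) × (Fin φ.q → Fin q) => instCode φ lj.1 lj.2

/-- The formally possible values of `th^n_k̄((M, P̄, ā), Φ)`, for `p` sets and `q` elements. -/
noncomputable def possth {L : FinLang} (Φ : Finset (Fml L)) (k : List ℕ) (p : ℕ) :
    ℕ → ℕ → Finset ℕ
  | 0, q => powCodes (instCodes Φ p q)
  | n + 1, q => powCodes (possth Φ k p n (q + seq k n))

/-- The formally possible values of `Th^n_k̄((M, P̄), Φ)`, for `p` sets. -/
noncomputable def possTh {L : FinLang} (Φ : Finset (Fml L)) (k : List ℕ) : ℕ → ℕ → Finset ℕ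
  | 0, p => possth Φ k p 1 0
  | n + 1, p => powCodes (possTh Φ k n (p + seq k (n + 1)))

/-- The sequence `⟨…, Q_t, …⟩`, `Q_t = {i ∈ N : t_i = t}`, where `t` runs in increasing order over
the finite set `T` of codes. -/
noncomputable def typeSets {N : Type u} (T : Finset ℕ) (t : N → ℕ) : List (Set N) :=
  (T.sort (· ≤ ·)).map fun s => {i | t i = s}

/-! Every actual theory is formally possible; in particular `hf` is only applied to finite sets. -/

theorem hf_mem_powCodes {S : Set ℕ} {A : Finset ℕ} (h : S ⊆ A) : hf S ∈ powCodes A := by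
  classical
  have hfin : S.Finite := A.finite_toSet.subset h
  refine Finset.mem_image.2 ⟨hfin.toFinset, ?_, ?_⟩
  · rw [Finset.mem_powerset]
    intro x hx
    exact h (hfin.mem_toFinset.1 hx)
  · rw [hf, ← finsum_mem_finset_eq_sum]
    simp

theorem th_mem_possth {L : FinLang} {M : Type u} [L.lang.Structure M] (Φ : Finset (Fml L))
    (k : List ℕ) (P : List (Set M)) (n : ℕ) (a : List M) :
    th Φ k P n a ∈ possth Φ k P.length n a.length := by
  induction n generalizing a with
  | zero =>
    refine hf_mem_powCodes ?_
    rintro c ⟨φ, hφ, l, j, -, rfl⟩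
    exact Finset.mem_coe.2 (Finset.mem_biUnion.2
      ⟨φ, hφ, Finset.mem_image.2 ⟨(l, j), Finset.mem_univ _, rfl⟩⟩)
  | succ n ih =>
    refine hf_mem_powCodes ?_
    rintro c ⟨b, hb, rfl⟩
    have := ih (a ++ b)
    rwa [List.length_append, hb] at this

theorem Th_mem_possTh {L : FinLang} {M : Type u} [L.lang.Structure M] (Φ : Finset (Fml L))
    (k : List ℕ) (n : ℕ) (P : List (Set M)) :
    Th Φ k n P ∈ possTh Φ k n P.length := by
  induction n generalizing P with
  | zero => exact th_mem_possth Φ k P 1 []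
  | succ n ih =>
    refine hf_mem_powCodes ?_
    rintro c ⟨Q, hQ, rfl⟩
    have := ih (P ++ Q)
    rwa [List.length_append, hQ] at this

/-! ### Generalized sums -/

/-- A formula `φ(x_{v_0}, …, x_{v_{q-1}})` of `L` with `v_0, …, v_{q-1} < n`. -/
structure Inst (L : FinLang) (n : ℕ) where
  q : ℕ
  form : L.lang.Formula (Fin q)
  v : Fin q → Fin n

/-- An `n`-condition `⟨E, Φ, Ψ⟩`. -/
structure Cond (L₁ L₂ : FinLang) (n : ℕ) where
  E : Setoid (Fin n)
  Φ : Finset (Inst L₁ n)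
  Ψ : Finset (Inst L₂ n)
  /-- a formula of `Φ` is about at least one of the variables -/
  pos : ∀ f ∈ Φ, 0 < f.q
  /-- all variables of a formula of `Φ` are `E`-equivalent -/
  equiv : ∀ f ∈ Φ, ∀ s s', E (f.v s) (f.v s')

/-- The sequence `x_0, …, x_{n-1}` of elements of the disjoint union of the `M i` satisfies `τ`. -/
def Cond.Sat {L₁ L₂ : FinLang} {n : ℕ} (τ : Cond L₁ L₂ n)
    {N : Type u} [L₂.lang.Structure N] {M : N → Type v} [∀ i, L₁.lang.Structure (M i)]
    (x : Fin n → Σ i, M i) : Prop :=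
  (∀ l m, (x l).1 = (x m).1 ↔ τ.E l m) ∧
  (∀ f ∈ τ.Φ, ∃ (i : N) (a : Fin f.q → M i), (∀ s, x (f.v s) = ⟨i, a s⟩) ∧ f.form.Realize a) ∧
  (∀ g ∈ τ.Ψ, g.form.Realize fun s => (x (g.v s)).1)

/-- A rule `σ = ⟨L₁, L₂, L₃, σ*⟩`; the language `L₃` is given by the arities of its predicates. -/
structure Rule where
  L₁ : FinLang
  L₂ : FinLang
  L₃ : List ℕ
  cond : ∀ R : Fin L₃.length, Finset (Cond L₁ L₂ (L₃.get R))

/-- The generalized sum `∑^σ_{i ∈ N} M i`, an `L₃`-model on the disjoint union of the `M i`. -/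
@[reducible] def Rule.sumStructure (σ : Rule) (N : Type u) [σ.L₂.lang.Structure N] (M : N → Type v)
    [∀ i, σ.L₁.lang.Structure (M i)] : (relLang σ.L₃).lang.Structure (Σ i, M i) where
  funMap f _ := f.1.elim0
  RelMap R x := ∃ τ ∈ σ.cond R.1, τ.Sat fun l => x (Fin.cast R.2 l)

/-- `Φ(σ)`: the formulas of `L₁` that appear in `σ`, equality, and membership in the
distinguished sets. -/
noncomputable def Rule.Phi (σ : Rule) : Finset (Fml σ.L₁) :=
  open Classical in
  (Finset.univ.biUnion fun R => (σ.cond R).biUnion fun τ => τ.Φ.image fun f => ofFormula f.form)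
  ∪ {eqFml _, memFml _}

/-- `Ψ(σ)`: the formulas of `L₂` that appear in `σ`, equality, and membership in the
distinguished sets. -/
noncomputable def Rule.Psi (σ : Rule) : Finset (Fml σ.L₂) :=
  open Classical in
  (Finset.univ.biUnion fun R => (σ.cond R).biUnion fun τ => τ.Ψ.image fun f => ofFormula f.form)
  ∪ {eqFml _, memFml _}

def Inst.code {L : FinLang} {n : ℕ} (f : Inst L n) : ℕ :=
  Encodable.encode (f.q, L.code f.form, List.ofFn fun s => (f.v s : ℕ))

noncomputable def Cond.code {L₁ L₂ : FinLang} {n : ℕ} (τ : Cond L₁ L₂ n) : ℕ :=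
  Encodable.encode (hf {c | ∃ l m : Fin n, τ.E l m ∧ c = Nat.pair l m},
    hf (Inst.code '' (τ.Φ : Set (Inst L₁ n))), hf (Inst.code '' (τ.Ψ : Set (Inst L₂ n))))

/-- The natural number by which a rule is given to an algorithm. -/
noncomputable def Rule.code (σ : Rule) : ℕ :=
  Encodable.encode (σ.L₁.fns, σ.L₁.rels, σ.L₂.fns, σ.L₂.rels, σ.L₃,
    List.ofFn fun R => hf (Cond.code '' (σ.cond R : Set (Cond σ.L₁ σ.L₂ (σ.L₃.get R)))))

/-- The `n`-theory of a generalized sum `∑^σ_{i ∈ N} M i` with the predicates `⋃_i P_i`. -/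
noncomputable def Rule.sumTh (σ : Rule) (n : ℕ) (k : List ℕ) {m : ℕ} {N : Type u}
    [σ.L₂.lang.Structure N] {M : N → Type v} [∀ i, σ.L₁.lang.Structure (M i)]
    (P : ∀ i, Fin m → Set (M i)) : ℕ :=
  letI := σ.sumStructure N M
  Th (atomic σ.L₃) k n (List.ofFn fun l => {x : Σ i, M i | x.2 ∈ P x.1 l})

/-! ### Orders -/

/-- The arities of the language `{<}` of orders. -/
def ordArity : List ℕ := [2]

/-- A linear order as a model of the language `{<}`. -/
@[reducible] def ordStructure (α : Type u) [LinearOrder α] : (relLang ordArity).lang.Structure α where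
  funMap f _ := f.1.elim0
  RelMap _ x := ∃ a b, List.ofFn x = [a, b] ∧ a < b

/-- `Th^n_k̄(α, P̄)` (over the atomic formulas) for a linear order `α`. -/
noncomputable def ordTh (k : List ℕ) (n : ℕ) {α : Type u} [LinearOrder α] (P : List (Set α)) : ℕ :=
  letI := ordStructure α
  Th (atomic ordArity) k n P

end MonadicSum

namespace MonadicSum

open FirstOrder.Language

/-! ### Codes of finite sets -/

/-! The proof is an induction on the level `j ≤ n`, from the quantifier-free bottom upwards. The
claim at level `j` concerns families `Q` of subsets of the summands and the index model `N` expanded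
by the sets `thSets σ.Phi k j Q`, which record the level-`j` theory of each summand, preceded by a
list `X` of other sets of known length.

Bottom level. A tuple of the sum, of length `k̄(0)`, is a tuple of indices together with elements of
the corresponding summands. Its atomic theory depends only on the theory of the index tuple and, for
each position `e`, on the theory of one tuple in the summand at `e` that has the right entries at
all positions of that summand (`comp_eq_th`). Conversely, theories `s e` can be realized
simultaneously iff each belongs to the theory of its summand and positions with equal indices get
equal theories. This is visible in the index theory, because it knows the type set of each index
(`choice_iff`, `sumTh0_eq`). An empty summand has empty level-0 theory, so it is never chosen.

Inductive step. A sequence of new subsets of the sum is an independent choice of sequences `W` in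
all summands. On the index side it corresponds to new sets `Z`, as many as there are formally
possible level-`j` theories; this is why `r̄(j+1)` is that number. The sets `Z` come from some `W`
iff they partition `N` and each index in the cell of `t` has `t` as an element of its level-`(j+1)`
theory (`valid_iff`). Both conditions concern one index at a time, so they can be read off from the
theory of `(N, X, …, Z)` after descending to its quantifier-free constituents. Keeping the valid
theories and applying the induction hypothesis to each gives the theory of the sum (`sumTh_eq`).

Computability. A finite set of codes is a number, read through its binary digits, and Gödel numbers
are injective. Hence all tests become bit tests, and the functions obtained are even primitive
recursive. -/

theorem eq_of_pairwise_lt {l m : List ℕ} (hl : l.Pairwise (· < ·)) (hm : m.Pairwise (· < ·))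
    (h : ∀ x, x ∈ l ↔ x ∈ m) : l = m :=
  ((List.perm_ext_iff_of_nodup hl.nodup hm.nodup).2 h).eq_of_pairwise
    (fun _ _ _ _ h1 h2 => absurd h1 h2.asymm) hl hm

theorem hf_coe (A : Finset ℕ) : hf (A : Set ℕ) = ∑ a ∈ A, 2 ^ a :=
  finsum_mem_coe_finset (fun a => 2 ^ a) A

theorem bitIndices_sum (A : Finset ℕ) : (∑ a ∈ A, 2 ^ a).bitIndices = A.sort (· ≤ ·) := by
  refine eq_of_pairwise_lt Nat.bitIndices_sorted.pairwise A.sortedLT_sort.pairwise fun x => ?_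
  rw [← List.mem_toFinset, Finset.toFinset_bitIndices_sum_two_pow]
  simp

theorem mem_bitIndices_hf {S : Set ℕ} (hS : S.Finite) {a : ℕ} :
    a ∈ (hf S).bitIndices ↔ a ∈ S := by
  lift S to Finset ℕ using hS
  rw [hf_coe, bitIndices_sum]
  simp

theorem testBit_hf {S : Set ℕ} (hS : S.Finite) {a : ℕ} : (hf S).testBit a = true ↔ a ∈ S := by
  rw [← Nat.mem_bitIndices, mem_bitIndices_hf hS]

/-- The code of the set of the entries of a list. -/
def mkCode (l : List ℕ) : ℕ := l.foldr (fun a t => if t.testBit a then t else t + 2 ^ a) 0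

/-- The bit test before each addition makes repeated entries harmless, so the code depends only on
the set of entries. -/
theorem mkCode_eq_hf (l : List ℕ) : mkCode l = hf {a | a ∈ l} := by
  have h : ∀ l : List ℕ, mkCode l = ∑ a ∈ l.toFinset, 2 ^ a := by
    intro l
    induction l with
    | nil => simp [mkCode]
    | cons a l ih =>
      have h1 : mkCode (a :: l) = if (mkCode l).testBit a then mkCode l else mkCode l + 2 ^ a := rfl
      have h2 : (mkCode l).testBit a = true ↔ a ∈ l := by
        rw [ih, ← Nat.mem_bitIndices, bitIndices_sum]
        simp
      rw [h1, List.toFinset_cons]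
      split_ifs with h3
      · rw [Finset.insert_eq_of_mem (by simpa using h2.1 h3), ih]
      · rw [Finset.sum_insert (by simpa using fun h => h3 (h2.2 h)), ih, add_comm]
  rw [h, ← hf_coe]
  congr 1
  ext
  simp

theorem mkCode_eq {l : List ℕ} {S : Set ℕ} (h : ∀ a, a ∈ l ↔ a ∈ S) : mkCode l = hf S := by
  rw [mkCode_eq_hf]
  congr 1
  ext a
  exact h a

@[simp] theorem mem_bitIndices_mkCode {l : List ℕ} {a : ℕ} : a ∈ (mkCode l).bitIndices ↔ a ∈ l := by
  rw [mkCode_eq_hf, mem_bitIndices_hf l.finite_toSet]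
  rfl

/-- A nonzero digit at `a` forces `a < 2 ^ a ≤ t`. So the elements of a coded set are found by a
bounded search, which makes the digit list primitive recursive. -/
theorem bitIndices_eq_filter (t : ℕ) : t.bitIndices = (List.range t).filter fun a => t.testBit a := by
  refine eq_of_pairwise_lt Nat.bitIndices_sorted.pairwise
    (List.pairwise_lt_range.filter _) fun x => ?_
  simp only [Nat.mem_bitIndices, List.mem_filter, List.mem_range, iff_and_self]
  exact fun h => x.lt_two_pow_self.trans_le (Nat.ge_two_pow_of_testBit h)

/-! ### Gödel numbers determine formulas -/

/-- The hypothesis on symbols compares them across arities: equal numbers must force equal arities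
before the argument tuples can be compared at all. -/
theorem termCode_injective {L : FirstOrder.Language.{0, 0}} {cf : ∀ n, L.Functions n → ℕ}
    (hcf : ∀ {n n'} (f : L.Functions n) (f' : L.Functions n'), cf n f = cf n' f' →
      (⟨n, f⟩ : Σ n, L.Functions n) = ⟨n', f'⟩) {q n : ℕ} :
    Function.Injective (termCode cf : L.Term (Fin q ⊕ Fin n) → ℕ) := by
  intro t
  induction t with
  | var a =>
    intro s h
    rcases s with b | ⟨g, ss⟩
    · rcases a with a | a <;> rcases b with b | b <;>
        simp_all [termCode, Nat.pair_eq_pair, Fin.ext_iff]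
    · rcases a with a | a <;> simp [termCode, Nat.pair_eq_pair] at h
  | func f ts ih =>
    intro s h
    rcases s with b | ⟨g, ss⟩
    · rcases b with b | b <;> simp [termCode, Nat.pair_eq_pair] at h
    · simp only [termCode, Nat.pair_eq_pair, true_and] at h
      obtain ⟨h1, h2⟩ := h
      cases hcf _ _ h1
      have h3 := List.ofFn_injective (Encodable.encode_injective h2)
      congr 1
      funext i
      exact ih i (congrFun h3 i)

theorem formulaCode_injective {L : FirstOrder.Language.{0, 0}} {cf : ∀ n, L.Functions n → ℕ}
    {cr : ∀ n, L.Relations n → ℕ}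
    (hcf : ∀ {n n'} (f : L.Functions n) (f' : L.Functions n'), cf n f = cf n' f' →
      (⟨n, f⟩ : Σ n, L.Functions n) = ⟨n', f'⟩)
    (hcr : ∀ {n n'} (f : L.Relations n) (f' : L.Relations n'), cr n f = cr n' f' →
      (⟨n, f⟩ : Σ n, L.Relations n) = ⟨n', f'⟩) {q n : ℕ} :
    Function.Injective (formulaCode cf cr : L.BoundedFormula (Fin q) n → ℕ) := by
  intro φ
  induction φ with
  | falsum => intro ψ h; cases ψ <;> simp_all [formulaCode, Nat.pair_eq_pair]
  | equal t s =>
    intro ψ h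
    cases ψ <;> simp [formulaCode, Nat.pair_eq_pair] at h
    rw [termCode_injective hcf h.1, termCode_injective hcf h.2]
  | rel R ts =>
    intro ψ h
    cases ψ <;> simp [formulaCode, Nat.pair_eq_pair] at h
    obtain ⟨h1, h2⟩ := h
    cases hcr _ _ h1
    congr 1
    funext i
    exact termCode_injective hcf (congrFun (List.ofFn_injective h2) i)
  | imp φ ψ ih1 ih2 =>
    intro χ h
    cases χ <;> simp [formulaCode, Nat.pair_eq_pair] at h
    rw [ih1 h.1, ih2 h.2]
  | all φ ih =>
    intro χ h
    cases χ <;> simp [formulaCode, Nat.pair_eq_pair] at h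
    rw [ih h]

theorem FinLang.funCode_inj (L : FinLang) {n n' : ℕ} (f : L.lang.Functions n)
    (f' : L.lang.Functions n') (h : L.funCode n f = L.funCode n' f') :
    (⟨n, f⟩ : Σ n, L.lang.Functions n) = ⟨n', f'⟩ := by
  obtain ⟨i, rfl⟩ := f
  obtain ⟨i', rfl⟩ := f'
  cases Fin.ext (show (i : ℕ) = i' from h)
  rfl

theorem FinLang.relCode_inj (L : FinLang) {n n' : ℕ} (f : L.lang.Relations n)
    (f' : L.lang.Relations n') (h : L.relCode n f = L.relCode n' f') :
    (⟨n, f⟩ : Σ n, L.lang.Relations n) = ⟨n', f'⟩ := by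
  obtain ⟨i, rfl⟩ := f
  obtain ⟨i', rfl⟩ := f'
  cases Fin.ext (Nat.eq_of_mul_eq_mul_left two_pos (show 2 * (i : ℕ) = 2 * i' from h))
  rfl

theorem FinLang.setsFunCode_inj (L : FinLang) (p : ℕ) {n n' : ℕ} (f : (L.withSets p).Functions n)
    (f' : (L.withSets p).Functions n') (h : L.setsFunCode p n f = L.setsFunCode p n' f') :
    (⟨n, f⟩ : Σ n, (L.withSets p).Functions n) = ⟨n', f'⟩ := by
  rcases f with f | f
  · rcases f' with f' | f'
    · cases L.funCode_inj f f' h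
      rfl
    · exact f'.elim
  · exact f.elim

theorem FinLang.setsRelCode_inj (L : FinLang) (p : ℕ) {n n' : ℕ} (f : (L.withSets p).Relations n)
    (f' : (L.withSets p).Relations n') (h : L.setsRelCode p n f = L.setsRelCode p n' f') :
    (⟨n, f⟩ : Σ n, (L.withSets p).Relations n) = ⟨n', f'⟩ := by
  rcases f with f | ⟨i, hi⟩ <;> rcases f' with f' | ⟨i', hi'⟩
  · cases L.relCode_inj f f' h
    rfl
  · simp only [setsRelCode, relCode] at h
    omega
  · simp only [setsRelCode, relCode] at h
    omega
  · subst hi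
    subst hi'
    simp only [setsRelCode] at h
    cases Fin.ext (show (i : ℕ) = i' by omega)
    rfl

/-- The numbers of variables are part of the code, so both formulas live in the same language before
`formulaCode_injective` is applied. Thanks to injectivity, one bit of an atomic theory speaks about
one formula instance only. -/
theorem Fml.code_injective (L : FinLang) : Function.Injective (Fml.code : Fml L → ℕ) := by
  rintro ⟨p, q, φ⟩ ⟨p', q', φ'⟩ h
  have h1 := Encodable.encode_injective h
  simp only [Prod.mk.injEq] at h1
  obtain ⟨rfl, rfl, h1⟩ := h1
  rw [formulaCode_injective (L.setsFunCode_inj p) (L.setsRelCode_inj p) h1]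

theorem termCode_onTerm {L : FinLang} {q n : ℕ} (t : L.lang.Term (Fin q ⊕ Fin n)) :
    termCode (L.setsFunCode 0) ((LHom.sumInl : L.lang →ᴸ L.withSets 0).onTerm t)
      = termCode L.funCode t := by
  induction t with
  | var a => rcases a with a | a <;> rfl
  | func f ts ih => simp only [LHom.onTerm, termCode, ih]; rfl

theorem formulaCode_onBoundedFormula {L : FinLang} {q n : ℕ} (φ : L.lang.BoundedFormula (Fin q) n) :
    formulaCode (L.setsFunCode 0) (L.setsRelCode 0)
        ((LHom.sumInl : L.lang →ᴸ L.withSets 0).onBoundedFormula φ)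
      = formulaCode L.funCode L.relCode φ := by
  induction φ with
  | falsum => rfl
  | equal t s => simp only [LHom.onBoundedFormula, formulaCode, Term.bdEqual, termCode_onTerm]
  | rel R ts =>
    simp only [LHom.onBoundedFormula, formulaCode, Relations.boundedFormula, Function.comp_apply,
      termCode_onTerm]
    rfl
  | imp φ ψ ih1 ih2 => simp only [LHom.onBoundedFormula, formulaCode, ih1, ih2]
  | all φ ih => simp only [LHom.onBoundedFormula, formulaCode, ih]

/-- Adjoining set variables does not renumber the symbols of `L`. The code of a formula inside a
rule therefore yields its code as a member of `Φ(σ)` or `Ψ(σ)` without decoding the formula. -/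
theorem code_ofFormula {L : FinLang} {q : ℕ} (φ : L.lang.Formula (Fin q)) :
    (ofFormula φ).code = Encodable.encode (0, q, L.code φ) := by
  simp only [Fml.code, ofFormula, LHom.onFormula, formulaCode_onBoundedFormula, FinLang.code]

/-! ### Primitive recursive functions -/

section Primrec

variable {α β γ δ : Type*} [Primcodable α] [Primcodable β] [Primcodable γ] [Primcodable δ]

-- The closure properties are stated with every argument depending on a common parameter, so that
-- `fun_prop` can decompose the algorithms syntactically.
attribute [fun_prop] Primrec

@[fun_prop] theorem primrec_id : Primrec fun x : α => x := Primrec.id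

@[fun_prop] theorem primrec_const (b : β) : Primrec fun _ : α => b := Primrec.const b

@[fun_prop] theorem primrec_comp {f : β → γ} {g : α → β} (hf : Primrec f) (hg : Primrec g) :
    Primrec fun x => f (g x) := hf.comp hg

@[fun_prop] theorem primrec_fst {f : α → β × γ} (hf : Primrec f) : Primrec fun x => (f x).1 :=
  Primrec.fst.comp hf

@[fun_prop] theorem primrec_snd {f : α → β × γ} (hf : Primrec f) : Primrec fun x => (f x).2 :=
  Primrec.snd.comp hf

@[fun_prop] theorem primrec_mk {f : α → β} {g : α → γ} (hf : Primrec f) (hg : Primrec g) :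
    Primrec fun x => (f x, g x) := hf.pair hg

@[fun_prop] theorem primrec_add {f g : α → ℕ} (hf : Primrec f) (hg : Primrec g) :
    Primrec fun x => f x + g x := Primrec.nat_add.comp hf hg

@[fun_prop] theorem primrec_sub {f g : α → ℕ} (hf : Primrec f) (hg : Primrec g) :
    Primrec fun x => f x - g x := Primrec.nat_sub.comp hf hg

@[fun_prop] theorem primrec_mul {f g : α → ℕ} (hf : Primrec f) (hg : Primrec g) :
    Primrec fun x => f x * g x := Primrec.nat_mul.comp hf hg

@[fun_prop] theorem primrec_natPair {f g : α → ℕ} (hf : Primrec f) (hg : Primrec g) :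
    Primrec fun x => Nat.pair (f x) (g x) := Primrec₂.natPair.comp hf hg

@[fun_prop] theorem primrec_pow {f g : α → ℕ} (hf : Primrec f) (hg : Primrec g) :
    Primrec fun x => f x ^ g x :=
  (Primrec₂.unpaired'.1 Nat.Primrec.pow).comp hf hg

@[fun_prop] theorem primrec_testBit {f g : α → ℕ} (hf : Primrec f) (hg : Primrec g) :
    Primrec fun x => (f x).testBit (g x) := by
  have h : Primrec fun x => decide (f x / 2 ^ g x % 2 = 1) :=
    (Primrec.eq.comp (Primrec.nat_mod.comp (Primrec.nat_div.comp hf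
      (primrec_pow (primrec_const 2) hg)) (primrec_const 2)) (primrec_const 1)).decide
  exact h.of_eq fun x => Nat.testBit_eq_decide_div_mod_eq.symm

@[fun_prop] theorem primrec_encode {f : α → β} (hf : Primrec f) :
    Primrec fun x => Encodable.encode (f x) := Primrec.encode.comp hf

@[fun_prop] theorem primrec_ofNat {γ : Type*} [Denumerable γ] {f : α → ℕ} (hf : Primrec f) :
    Primrec fun x => Denumerable.ofNat γ (f x) := (Primrec.ofNat γ).comp hf

@[fun_prop] theorem primrec_ite {c : α → Bool} {f g : α → β} (hc : Primrec c) (hf : Primrec f)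
    (hg : Primrec g) : Primrec fun x => if c x = true then f x else g x :=
  (Primrec.cond hc hf hg).of_eq fun x => by cases c x <;> rfl

@[fun_prop] theorem primrec_and {f g : α → Bool} (hf : Primrec f) (hg : Primrec g) :
    Primrec fun x => f x && g x := Primrec.and.comp hf hg

@[fun_prop] theorem primrec_or {f g : α → Bool} (hf : Primrec f) (hg : Primrec g) :
    Primrec fun x => f x || g x := Primrec.or.comp hf hg

@[fun_prop] theorem primrec_not {f : α → Bool} (hf : Primrec f) :
    Primrec fun x => !f x := Primrec.not.comp hf

@[fun_prop] theorem primrec_beq [DecidableEq β] {f g : α → β} (hf : Primrec f) (hg : Primrec g) :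
    Primrec fun x => f x == g x := Primrec.beq.comp hf hg

@[fun_prop] theorem primrec_cons {f : α → β} {g : α → List β} (hf : Primrec f) (hg : Primrec g) :
    Primrec fun x => f x :: g x := Primrec.list_cons.comp hf hg

@[fun_prop] theorem primrec_append {f g : α → List β} (hf : Primrec f) (hg : Primrec g) :
    Primrec fun x => f x ++ g x := Primrec.list_append.comp hf hg

@[fun_prop] theorem primrec_range {f : α → ℕ} (hf : Primrec f) :
    Primrec fun x => List.range (f x) := Primrec.list_range.comp hf

@[fun_prop] theorem primrec_length {f : α → List β} (hf : Primrec f) :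
    Primrec fun x => (f x).length := Primrec.list_length.comp hf

@[fun_prop] theorem primrec_headI [Inhabited β] {f : α → List β} (hf : Primrec f) :
    Primrec fun x => (f x).headI := Primrec.list_headI.comp hf

@[fun_prop] theorem primrec_getD {f : α → List β} {g : α → ℕ} (d : β) (hf : Primrec f)
    (hg : Primrec g) : Primrec fun x => (f x).getD (g x) d := (Primrec.list_getD d).comp hf hg

@[fun_prop] theorem primrec_map {f : α → List β} {g : α → β → γ} (hf : Primrec f)
    (hg : Primrec fun p : α × β => g p.1 p.2) : Primrec fun x => (f x).map (g x) :=
  Primrec.list_map hf hg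

@[fun_prop] theorem primrec_flatMap {f : α → List β} {g : α → β → List γ} (hf : Primrec f)
    (hg : Primrec fun p : α × β => g p.1 p.2) : Primrec fun x => (f x).flatMap (g x) :=
  Primrec.list_flatMap hf hg

@[fun_prop] theorem primrec_foldr {f : α → List β} {a : α → γ} {g : α → β → γ → γ}
    (hf : Primrec f) (ha : Primrec a) (hg : Primrec fun p : α × β × γ => g p.1 p.2.1 p.2.2) :
    Primrec fun x => (f x).foldr (g x) (a x) :=
  Primrec.list_foldr (h := fun x p => g x p.1 p.2) hf ha hg

@[fun_prop] theorem primrec_filter {f : α → List β} {g : α → β → Bool} (hf : Primrec f)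
    (hg : Primrec fun p : α × β => g p.1 p.2) : Primrec fun x => (f x).filter (g x) := by
  have h : Primrec fun x => (f x).flatMap fun y => if g x y = true then [y] else [] := by fun_prop
  refine h.of_eq fun x => ?_
  induction f x with
  | nil => rfl
  | cons y l ih => cases h : g x y <;> simp [h, ih]

@[fun_prop] theorem primrec_all {f : α → List β} {g : α → β → Bool} (hf : Primrec f)
    (hg : Primrec fun p : α × β => g p.1 p.2) : Primrec fun x => (f x).all (g x) := by
  have h : Primrec fun x => (f x).foldr (fun y b => g x y && b) true := by fun_prop
  refine h.of_eq fun x => ?_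
  induction f x with
  | nil => rfl
  | cons y l ih => simp [ih]

@[fun_prop] theorem primrec_any {f : α → List β} {g : α → β → Bool} (hf : Primrec f)
    (hg : Primrec fun p : α × β => g p.1 p.2) : Primrec fun x => (f x).any (g x) := by
  have h : Primrec fun x => (f x).foldr (fun y b => g x y || b) false := by fun_prop
  refine h.of_eq fun x => ?_
  induction f x with
  | nil => rfl
  | cons y l ih => simp [ih]

@[fun_prop] theorem primrec_natRec {n : α → ℕ} {a : α → γ} {g : α → ℕ → γ → γ}
    (hn : Primrec n) (ha : Primrec a) (hg : Primrec fun p : α × ℕ × γ => g p.1 p.2.1 p.2.2) :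
    Primrec fun x => Nat.rec (motive := fun _ => γ) (a x) (g x) (n x) :=
  Primrec.nat_rec' (h := fun x p => g x p.1 p.2) hn ha hg

@[fun_prop] theorem primrec_bitIndices {f : α → ℕ} (hf : Primrec f) :
    Primrec fun x => (f x).bitIndices := by
  have h : Primrec fun x => (List.range (f x)).filter fun a => (f x).testBit a := by fun_prop
  exact h.of_eq fun x => (bitIndices_eq_filter _).symm

end Primrec

/-! ### Algorithms -/

/-- The lists of length `n` with entries from the list `B`. -/
def listsOf {α : Type*} (B : List α) (n : ℕ) : List (List α) :=
  Nat.rec [[]] (fun _ L => L.flatMap fun l => B.map (· :: l)) n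

/-- The code of the set of codes of subsets of the set coded by `t`. -/
def powCode (t : ℕ) : ℕ :=
  mkCode ((List.range (t + 1)).filter fun s => s.bitIndices.all fun a => t.testBit a)

/-- The `n`-fold iterate of `powCode`. -/
def powIter (t n : ℕ) : ℕ := Nat.rec t (fun _ s => powCode s) n

/-- The code of an instance of the formula with code `c`. -/
def inst (c : ℕ) (l j : List ℕ) : ℕ := Encodable.encode (c, l, j)

/-- The code of the formula `x_0 = x_1`. -/
def eqCode : ℕ := Encodable.encode (0, 2, Nat.pair 1 (Nat.pair (Nat.pair 0 0) (Nat.pair 0 1)))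

/-- The code of the formula `x_0 ∈ X_0`. -/
def memCode : ℕ :=
  Encodable.encode (1, 1, Nat.pair 2 (Nat.pair 1 (Encodable.encode [Nat.pair 0 0])))

/-- The code of the formula `R(x_0, …, x_{n-1})` for the predicate `R` with index `i`. -/
def atomCode (i n : ℕ) : ℕ :=
  Encodable.encode
    (0, n, Nat.pair 2 (Nat.pair (2 * i) (Encodable.encode ((List.range n).map (Nat.pair 0)))))

/-- The data of a rule. -/
abbrev RuleData := List ℕ × List ℕ × List ℕ × List ℕ × List ℕ × List ℕ

/-- The codes of the formulas `Φ(σ)`. -/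
def phiCodes (d : RuleData) : List ℕ :=
  eqCode :: memCode :: d.2.2.2.2.2.flatMap fun h => h.bitIndices.flatMap fun τ =>
    (Denumerable.ofNat (ℕ × ℕ × ℕ) τ).2.1.bitIndices.map fun f =>
      Encodable.encode (0, (Denumerable.ofNat (ℕ × ℕ × List ℕ) f).1,
        (Denumerable.ofNat (ℕ × ℕ × List ℕ) f).2.1)

/-- The codes of the instances of the formulas with codes in `Φ`, for `p` sets and `q` elements. -/
def instList (Φ : List ℕ) (p q : ℕ) : List ℕ :=
  Φ.flatMap fun c => (listsOf (List.range p) (Denumerable.ofNat (ℕ × ℕ × ℕ) c).1).flatMap fun l =>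
    (listsOf (List.range q) (Denumerable.ofNat (ℕ × ℕ × ℕ) c).2.1).map fun j => inst c l j

/-- The sum of `k̄(1), …, k̄(n)`. -/
def setSum (k : List ℕ) (n : ℕ) : ℕ := Nat.rec 0 (fun i s => s + seq k (i + 1)) n

/-- The parameters of the algorithm: the data of the rule, `n`, `k̄(0)`, and the code of
the set of formal instances with all sets and all elements that occur in the end. -/
abbrev Param := RuleData × ℕ × ℕ × ℕ

/-- The parameters given by a rule, `n`, the number `m` of sets, and `k̄`. -/
def Param.mk (d : RuleData) (n m : ℕ) (k : List ℕ) : Param :=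
  (d, n, seq k 0, mkCode (instList (phiCodes d) (m + setSum k n) (seq k 0)))

namespace Param

/-- The list of the formally possible theories at level `j`. -/
def types (x : Param) (j : ℕ) : List ℕ := (powIter x.2.2.2 (j + 2)).bitIndices

/-- The number of formally possible theories at levels below `j`. -/
def total (x : Param) (j : ℕ) : ℕ := Nat.rec 0 (fun i s => s + (x.types i).length) j

/-- The number of sets preceding the sets of the formally possible theories at level `j`. -/
def offset (x : Param) (j : ℕ) : ℕ := x.total (x.2.1 + 1) - x.total (j + 1)

/-- Does `x_e ∈ X_s` belong to the set of instances with code `u`? -/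
def holdsMem (u s e : ℕ) : Bool := u.testBit (inst memCode [s] [e])

/-- Does `x_e = x_e'` belong to the set of instances with code `u`? -/
def holdsEq (u e e' : ℕ) : Bool := u.testBit (inst eqCode [] [e, e'])

/-- Some element of the set coded by `t`. -/
def pick (t j : ℕ) : ℕ := Nat.rec t (fun _ s => s.bitIndices.headI) j

/-- Does the element `x_0` with the type `u` belong to exactly one of the type sets
at level `j`, of a theory that is an element of its theory at level `j + 1`? -/
def validAt (x : Param) (j u : ℕ) : Bool :=
  (List.range (x.types j).length).any fun l =>
    holdsMem u (x.offset j + l) 0 &&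
    ((List.range (x.types j).length).all fun l' => !holdsMem u (x.offset j + l') 0 || l' == l) &&
    (List.range (x.types (j + 1)).length).any fun l' =>
      holdsMem u (x.offset (j + 1) + l') 0 &&
        ((x.types (j + 1)).getD l' 0).testBit ((x.types j).getD l 0)

/-- Are the last sets in the theory `t` at level `j` the type sets of a refinement of the
families of sets in the summands? -/
def valid (x : Param) (j t : ℕ) : Bool := (pick t j).bitIndices.all fun u => x.validAt j u

/-- Is `s` a possible list of theories of tuples in the summands that contain the elements
`x_0, …` with type `u`? -/
def choice (x : Param) (u : ℕ) (s : List ℕ) : Bool :=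
  (List.range x.2.2.1).all fun e =>
    ((List.range (x.types 0).length).any fun l =>
      holdsMem u (x.offset 0 + l) e && ((x.types 0).getD l 0).testBit (s.getD e 0)) &&
    (List.range x.2.2.1).all fun e' => !holdsEq u e e' || s.getD e 0 == s.getD e' 0

/-- Does the tuple with indices `J` satisfy the condition with code `τ` of arity `n`? -/
def satCond (u : ℕ) (s : List ℕ) (n : ℕ) (J : List ℕ) (τ : ℕ) : Bool :=
  ((List.range n).all fun a => (List.range n).all fun b =>
    holdsEq u (J.getD a 0) (J.getD b 0) ==
      (Denumerable.ofNat (ℕ × ℕ × ℕ) τ).1.testBit (Nat.pair a b)) &&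
  ((Denumerable.ofNat (ℕ × ℕ × ℕ) τ).2.1.bitIndices.all fun f =>
    (s.getD (J.getD (Denumerable.ofNat (ℕ × ℕ × List ℕ) f).2.2.headI 0) 0).testBit
      (inst (Encodable.encode (0, (Denumerable.ofNat (ℕ × ℕ × List ℕ) f).1,
        (Denumerable.ofNat (ℕ × ℕ × List ℕ) f).2.1)) []
        ((Denumerable.ofNat (ℕ × ℕ × List ℕ) f).2.2.map fun v => J.getD v 0))) &&
  ((Denumerable.ofNat (ℕ × ℕ × ℕ) τ).2.2.bitIndices.all fun f =>
    u.testBit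
      (inst (Encodable.encode (0, (Denumerable.ofNat (ℕ × ℕ × List ℕ) f).1,
        (Denumerable.ofNat (ℕ × ℕ × List ℕ) f).2.1)) []
        ((Denumerable.ofNat (ℕ × ℕ × List ℕ) f).2.2.map fun v => J.getD v 0)))

/-- The atomic theory of a tuple of the sum, computed from the theory `u` of the indices and
the theories `s` in the summands; `p` is the number of sets. -/
def comp (x : Param) (p : ℕ) (u : ℕ) (s : List ℕ) : ℕ :=
  mkCode
    (((List.range x.1.2.2.2.2.1.length).flatMap fun i =>
        ((listsOf (List.range x.2.2.1) (x.1.2.2.2.2.1.getD i 0)).filter fun J =>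
          (x.1.2.2.2.2.2.getD i 0).bitIndices.any fun τ =>
            satCond u s (x.1.2.2.2.2.1.getD i 0) J τ).map
          fun J => inst (atomCode i (x.1.2.2.2.2.1.getD i 0)) [] J) ++
      ((List.range x.2.2.1).flatMap fun e => ((List.range x.2.2.1).filter fun e' =>
          holdsEq u e e' && holdsEq (s.getD e 0) e e').map fun e' => inst eqCode [] [e, e']) ++
      ((List.range x.2.2.1).flatMap fun e => ((List.range p).filter fun l =>
          holdsMem (s.getD e 0) l e).map fun l => inst memCode [l] [e]))

/-- The theory at level `0` of the sum, computed from that of the index model. -/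
def sumTh0 (x : Param) (p T : ℕ) : ℕ :=
  mkCode (T.bitIndices.flatMap fun u =>
    ((listsOf (powIter x.2.2.2 1).bitIndices x.2.2.1).filter fun s => x.choice u s).map fun s =>
      x.comp p u s)

/-- The theory at level `j` of the sum, computed from that of the index model. -/
def sumTh (x : Param) (p : ℕ) : ℕ → ℕ → ℕ
  | 0, T => x.sumTh0 p T
  | j + 1, T => mkCode ((T.bitIndices.filter fun t => x.valid j t).map fun t => sumTh x p j t)

/-- The table of the values `x.sumTh p j T` for `T < b`. -/
def table (x : Param) (p b j : ℕ) : List ℕ :=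
  Nat.rec ((List.range b).map fun T => x.sumTh0 p T)
    (fun i l => (List.range b).map fun T =>
      mkCode ((T.bitIndices.filter fun t => x.valid i t).map fun t => l.getD t 0)) j

end Param

/-- The sequence `r̄`. -/
def rSeq (y : ℕ × ℕ × ℕ × List ℕ) : List ℕ :=
  (seq y.2.2.2 0 + (Denumerable.ofNat RuleData y.1).2.2.2.1.foldr (fun a b => a + b) 0) ::
    (List.range y.2.1).map fun j =>
      ((Param.mk (Denumerable.ofNat RuleData y.1) y.2.1 y.2.2.1 y.2.2.2).types j).length

/-- The function `F`. -/
def sumFun (y : ℕ × ℕ × ℕ × List ℕ × ℕ) : ℕ :=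
  (Param.mk (Denumerable.ofNat RuleData y.1) y.2.1 y.2.2.1 y.2.2.2.1).sumTh
    (y.2.2.1 + setSum y.2.2.2.1 y.2.1) y.2.1 y.2.2.2.2

/-! ### Primitive recursiveness of the algorithms -/

section Primrec

variable {α β γ : Type*} [Primcodable α] [Primcodable β] [Primcodable γ]

@[fun_prop] theorem primrec_mkCode {f : α → List ℕ} (hf : Primrec f) :
    Primrec fun x => mkCode (f x) := by
  unfold mkCode; fun_prop

@[fun_prop] theorem primrec_listsOf {f : α → List β} {g : α → ℕ} (hf : Primrec f)
    (hg : Primrec g) : Primrec fun x => listsOf (f x) (g x) := by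
  unfold listsOf; fun_prop

@[fun_prop] theorem primrec_powCode : Primrec powCode := by
  unfold powCode; fun_prop

@[fun_prop] theorem primrec_powIter {f g : α → ℕ} (hf : Primrec f)
    (hg : Primrec g) : Primrec fun x => powIter (f x) (g x) := by
  unfold powIter; fun_prop

@[fun_prop] theorem primrec_inst {c : α → ℕ} {l j : α → List ℕ} (hc : Primrec c) (hl : Primrec l)
    (hj : Primrec j) : Primrec fun x => inst (c x) (l x) (j x) := by
  unfold inst; fun_prop

@[fun_prop] theorem primrec_atomCode {f g : α → ℕ} (hf : Primrec f)
    (hg : Primrec g) : Primrec fun x => atomCode (f x) (g x) := by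
  unfold atomCode; fun_prop

@[fun_prop] theorem primrec_phiCodes : Primrec phiCodes := by
  unfold phiCodes; fun_prop

@[fun_prop] theorem primrec_instList {Φ : α → List ℕ} {p q : α → ℕ} (hΦ : Primrec Φ)
    (hp : Primrec p) (hq : Primrec q) : Primrec fun x => instList (Φ x) (p x) (q x) := by
  unfold instList; fun_prop

@[fun_prop] theorem primrec_seq {k : α → List ℕ} {i : α → ℕ} (hk : Primrec k)
    (hi : Primrec i) : Primrec fun x => seq (k x) (i x) := by
  unfold seq; fun_prop

@[fun_prop] theorem primrec_setSum {k : α → List ℕ} {i : α → ℕ} (hk : Primrec k)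
    (hi : Primrec i) : Primrec fun x => setSum (k x) (i x) := by
  unfold setSum; fun_prop

namespace Param

@[fun_prop] theorem primrec_mk {d : α → RuleData} {n m : α → ℕ} {k : α → List ℕ} (hd : Primrec d)
    (hn : Primrec n) (hm : Primrec m) (hk : Primrec k) :
    Primrec fun x => Param.mk (d x) (n x) (m x) (k x) := by
  unfold Param.mk; fun_prop

variable {x : α → Param} {p j u v w : α → ℕ} {s J : α → List ℕ}

@[fun_prop] theorem primrec_types (hx : Primrec x) (hj : Primrec j) :
    Primrec fun y => (x y).types (j y) := by
  unfold types; fun_prop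

@[fun_prop] theorem primrec_total (hx : Primrec x) (hj : Primrec j) :
    Primrec fun y => (x y).total (j y) := by
  unfold total; fun_prop

@[fun_prop] theorem primrec_offset (hx : Primrec x) (hj : Primrec j) :
    Primrec fun y => (x y).offset (j y) := by
  unfold offset; fun_prop

@[fun_prop] theorem primrec_holdsMem (hu : Primrec u) (hv : Primrec v) (hw : Primrec w) :
    Primrec fun y => holdsMem (u y) (v y) (w y) := by
  unfold holdsMem; fun_prop

@[fun_prop] theorem primrec_holdsEq (hu : Primrec u) (hv : Primrec v) (hw : Primrec w) :
    Primrec fun y => holdsEq (u y) (v y) (w y) := by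
  unfold holdsEq; fun_prop

@[fun_prop] theorem primrec_pick (hu : Primrec u) (hj : Primrec j) :
    Primrec fun y => pick (u y) (j y) := by
  unfold pick; fun_prop

@[fun_prop] theorem primrec_validAt (hx : Primrec x) (hj : Primrec j) (hu : Primrec u) :
    Primrec fun y => (x y).validAt (j y) (u y) := by
  unfold validAt; fun_prop

@[fun_prop] theorem primrec_valid (hx : Primrec x) (hj : Primrec j) (hu : Primrec u) :
    Primrec fun y => (x y).valid (j y) (u y) := by
  unfold valid; fun_prop

@[fun_prop] theorem primrec_choice (hx : Primrec x) (hu : Primrec u) (hs : Primrec s) :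
    Primrec fun y => (x y).choice (u y) (s y) := by
  unfold choice; fun_prop

@[fun_prop] theorem primrec_satCond (hu : Primrec u) (hs : Primrec s) (hv : Primrec v)
    (hJ : Primrec J) (hw : Primrec w) :
    Primrec fun y => satCond (u y) (s y) (v y) (J y) (w y) := by
  unfold satCond; fun_prop

@[fun_prop] theorem primrec_comp (hx : Primrec x) (hp : Primrec p) (hu : Primrec u)
    (hs : Primrec s) : Primrec fun y => (x y).comp (p y) (u y) (s y) := by
  unfold comp; fun_prop

@[fun_prop] theorem primrec_sumTh0 (hx : Primrec x) (hp : Primrec p) (hu : Primrec u) :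
    Primrec fun y => (x y).sumTh0 (p y) (u y) := by
  unfold sumTh0; fun_prop

@[fun_prop] theorem primrec_table (hx : Primrec x) (hp : Primrec p) (hu : Primrec u)
    (hj : Primrec j) : Primrec fun y => (x y).table (p y) (u y) (j y) := by
  unfold table; fun_prop

/-- The recursion for `sumTh` calls level `j` at many arguments, so it is not literally a primitive
recursion. All these arguments are elements of the set coded by `T`, hence smaller than `T`, and a
table of the values below a fixed bound contains them. -/
theorem table_getD (x : Param) (p b j : ℕ) {T : ℕ} (hT : T < b) :
    (x.table p b j).getD T 0 = x.sumTh p j T := by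
  induction j generalizing T with
  | zero => simp [table, sumTh, hT]
  | succ j ih =>
    have h : x.table p b (j + 1) = (List.range b).map fun T =>
      mkCode ((T.bitIndices.filter fun t => x.valid j t).map fun t => (x.table p b j).getD t 0) :=
      rfl
    rw [h, sumTh]
    simp only [List.getD_eq_getElem?_getD, List.getElem?_map, List.getElem?_range hT,
      Option.map_some, Option.getD_some]
    congr 1
    refine List.map_congr_left fun t ht => ?_
    rw [← List.getD_eq_getElem?_getD, ih]
    have h1 := Nat.two_pow_le_of_mem_bitIndices (List.mem_of_mem_filter ht)
    exact (t.lt_two_pow_self.trans_le h1).trans hT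

@[fun_prop] theorem primrec_sumTh (hx : Primrec x) (hp : Primrec p) (hu : Primrec u)
    (hj : Primrec j) : Primrec fun y => (x y).sumTh (p y) (j y) (u y) := by
  have h : Primrec fun y => ((x y).table (p y) (u y + 1) (j y)).getD (u y) 0 := by fun_prop
  exact h.of_eq fun y => table_getD _ _ _ _ (Nat.lt_succ_self _)

end Param

theorem primrec_rSeq : Primrec rSeq := by
  unfold rSeq; fun_prop

theorem primrec_sumFun : Primrec sumFun := by
  unfold sumFun; fun_prop

end Primrec

/-! ### Membership in theories -/

@[simp] theorem mem_listsOf {α : Type*} {B : List α} {n : ℕ} {l : List α} :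
    l ∈ listsOf B n ↔ l.length = n ∧ ∀ x ∈ l, x ∈ B := by
  induction n generalizing l with
  | zero =>
    change l ∈ [[]] ↔ _
    simp only [List.mem_singleton, List.length_eq_zero_iff, iff_self_and]
    rintro rfl
    simp
  | succ n ih =>
    change l ∈ (listsOf B n).flatMap (fun l => B.map (· :: l)) ↔ _
    simp only [List.mem_flatMap, ih, List.mem_map]
    constructor
    · rintro ⟨m, ⟨rfl, hm⟩, y, hy, rfl⟩
      exact ⟨rfl, List.forall_mem_cons.2 ⟨hy, hm⟩⟩
    · rintro ⟨h1, h2⟩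
      obtain _ | ⟨y, m⟩ := l
      · cases h1
      · rw [List.forall_mem_cons] at h2
        exact ⟨m, ⟨Nat.succ_injective h1, h2.2⟩, y, h2.1, rfl⟩

theorem exists_ofFn_val_iff {p n : ℕ} {l : List ℕ} :
    (∃ f : Fin n → Fin p, List.ofFn (fun s => (f s : ℕ)) = l) ↔ l ∈ listsOf (List.range p) n := by
  rw [mem_listsOf]
  constructor
  · rintro ⟨f, rfl⟩
    simp only [List.length_ofFn, List.mem_ofFn, List.mem_range, true_and]
    rintro _ ⟨s, rfl⟩
    exact (f s).2
  · rintro ⟨rfl, h⟩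
    exact ⟨fun s => ⟨l.get s, List.mem_range.1 (h _ (List.get_mem l s))⟩, List.ofFn_get l⟩

theorem instCode_eq {L : FinLang} (φ : Fml L) {p q : ℕ} (l : Fin φ.p → Fin p)
    (j : Fin φ.q → Fin q) : instCode φ l j =
      inst φ.code (List.ofFn fun s => (l s : ℕ)) (List.ofFn fun s => (j s : ℕ)) := rfl

theorem inst_inj {c c' : ℕ} {l l' j j' : List ℕ} :
    inst c l j = inst c' l' j' ↔ c = c' ∧ l = l' ∧ j = j' := by
  simp [inst]

section
variable {L : FinLang} {M : Type u} [L.lang.Structure M] {Φ : Finset (Fml L)} {k : List ℕ}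
  {P : List (Set M)}

theorem finite_th_zero (a : List M) : {c | ∃ φ ∈ Φ, ∃ (l : Fin φ.p → Fin P.length)
    (j : Fin φ.q → Fin a.length),
      φ.Holds (fun s => P.get (l s)) (fun s => a.get (j s)) ∧ c = instCode φ l j}.Finite := by
  refine (instCodes Φ P.length a.length).finite_toSet.subset ?_
  rintro c ⟨φ, hφ, l, j, -, rfl⟩
  exact Finset.mem_coe.2 (Finset.mem_biUnion.2
    ⟨φ, hφ, Finset.mem_image.2 ⟨(l, j), Finset.mem_univ _, rfl⟩⟩)

theorem mem_bitIndices_th_succ {n : ℕ} {a : List M} {c : ℕ} :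
    c ∈ (th Φ k P (n + 1) a).bitIndices ↔
      ∃ b : List M, b.length = seq k n ∧ c = th Φ k P n (a ++ b) := by
  rw [th, mem_bitIndices_hf]
  · rfl
  · refine (possth Φ k P.length n (a.length + seq k n)).finite_toSet.subset ?_
    rintro c ⟨b, hb, rfl⟩
    have := th_mem_possth Φ k P n (a ++ b)
    rwa [List.length_append, hb] at this

theorem mem_bitIndices_Th_succ {n : ℕ} {c : ℕ} :
    c ∈ (Th Φ k (n + 1) P).bitIndices ↔
      ∃ Q : List (Set M), Q.length = seq k (n + 1) ∧ c = Th Φ k n (P ++ Q) := by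
  rw [Th, mem_bitIndices_hf]
  · rfl
  · refine (possTh Φ k n (P.length + seq k (n + 1))).finite_toSet.subset ?_
    rintro c ⟨b, hb, rfl⟩
    have := Th_mem_possTh Φ k n (P ++ b)
    rwa [List.length_append, hb] at this

/-- Injectivity of the codes excludes that the bit comes from another formula or another
substitution. Indices are arbitrary naturals here; out of range the bit is simply zero. -/
theorem testBit_th_zero {φ : Fml L} (hφ : φ ∈ Φ) {a : List M} (l : Fin φ.p → ℕ)
    (j : Fin φ.q → ℕ) :
    (th Φ k P 0 a).testBit (inst φ.code (List.ofFn l) (List.ofFn j)) = true ↔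
      ∃ (hl : ∀ s, l s < P.length) (hj : ∀ s, j s < a.length),
        φ.Holds (fun s => P[l s]'(hl s)) (fun s => a[j s]'(hj s)) := by
  rw [th, testBit_hf (finite_th_zero a)]
  constructor
  · rintro ⟨φ', -, l', j', h, h'⟩
    rw [instCode_eq, inst_inj] at h'
    obtain ⟨h1, h2, h3⟩ := h'
    cases Fml.code_injective L h1
    cases List.ofFn_injective h2
    cases List.ofFn_injective h3
    exact ⟨fun s => (l' s).2, fun s => (j' s).2, h⟩
  · rintro ⟨hl, hj, h⟩
    exact ⟨φ, hφ, fun s => ⟨l s, hl s⟩, fun s => ⟨j s, hj s⟩, h, rfl⟩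

theorem holds_ofFormula {q : ℕ} (φ : L.lang.Formula (Fin q))
    (P : Fin (ofFormula φ).p → Set M) (a : Fin (ofFormula φ).q → M) :
    (ofFormula φ).Holds P a ↔ φ.Realize (v := a) := by
  let : (setLang 0).Structure M := setStructure (p := 0) P
  have h := LHom.realize_onFormula (M := M) (LHom.sumInl : L.lang →ᴸ L.withSets 0) (v := a) φ
  exact h

theorem holds_eqFml (P : Fin (eqFml L).p → Set M) (a : Fin (eqFml L).q → M) :
    (eqFml L).Holds P a ↔ a (0 : Fin 2) = a (1 : Fin 2) :=
  (holds_ofFormula _ P a).trans Formula.realize_equal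

theorem holds_memFml (P : Fin (memFml L).p → Set M) (a : Fin (memFml L).q → M) :
    (memFml L).Holds P a ↔ a (0 : Fin 1) ∈ P (0 : Fin 1) := by
  let : (setLang 1).Structure M := setStructure (p := 1) P
  exact Formula.realize_rel₁ (L := L.withSets 1)

theorem holdsMem_th (hΦ : memFml L ∈ Φ) {a : List M} {s e : ℕ} :
    Param.holdsMem (th Φ k P 0 a) s e = true ↔
      ∃ (hs : s < P.length) (he : e < a.length), a[e] ∈ P[s] := by
  have h := testBit_th_zero (k := k) (P := P) (a := a) hΦ (fun _ => s) (fun _ => e)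
  refine h.trans ?_
  simp only [holds_memFml]
  exact ⟨fun ⟨h1, h2, h3⟩ => ⟨h1 (0 : Fin 1), h2 (0 : Fin 1), h3⟩,
    fun ⟨h1, h2, h3⟩ => ⟨fun _ => h1, fun _ => h2, h3⟩⟩

theorem holdsEq_th (hΦ : eqFml L ∈ Φ) {a : List M} {e e' : ℕ} :
    Param.holdsEq (th Φ k P 0 a) e e' = true ↔
      ∃ (he : e < a.length) (he' : e' < a.length), a[e] = a[e'] := by
  have h := testBit_th_zero (k := k) (P := P) (a := a) hΦ Fin.elim0 ![e, e']
  refine (show _ ↔ _ from h).trans ?_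
  simp only [holds_eqFml]
  exact ⟨fun ⟨_, h2, h3⟩ => ⟨h2 (0 : Fin 2), h2 (1 : Fin 2), h3⟩,
    fun ⟨h1, h2, h3⟩ => ⟨fun s => s.elim0, Fin.forall_fin_two.2 ⟨h1, h2⟩, h3⟩⟩

theorem testBit_th_ofFormula {q : ℕ} {φ : L.lang.Formula (Fin q)} (hφ : ofFormula φ ∈ Φ)
    {a : List M} (j : Fin q → ℕ) :
    (th Φ k P 0 a).testBit (inst (Encodable.encode (0, q, L.code φ)) [] (List.ofFn j)) = true ↔
      ∃ hj : ∀ s, j s < a.length, φ.Realize fun s => a[j s]'(hj s) := by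
  have h := testBit_th_zero (k := k) (P := P) (a := a) hφ Fin.elim0 j
  rw [code_ofFormula] at h
  refine (show _ ↔ _ from h).trans ?_
  simp only [holds_ofFormula]
  exact ⟨fun ⟨_, h2, h3⟩ => ⟨h2, h3⟩, fun ⟨h1, h2⟩ => ⟨fun s => s.elim0, h1, h2⟩⟩

end

/-! ### Formally possible theories -/

/-- The code of a subset is a partial sum of the code of the whole set, so the search up to the
latter misses no subset. -/
theorem powCode_hf (A : Finset ℕ) : powCode (hf (A : Set ℕ)) = hf (powCodes A : Set ℕ) := by
  refine mkCode_eq fun a => ?_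
  simp only [List.mem_filter, List.mem_range, List.all_eq_true, testBit_hf A.finite_toSet,
    Finset.mem_coe, powCodes, Finset.mem_image, Finset.mem_powerset]
  constructor
  · rintro ⟨-, h⟩
    exact ⟨a.bitIndices.toFinset, fun b hb => h b (List.mem_toFinset.1 hb),
      Finset.sum_toFinset_bitIndices_two_pow a⟩
  · rintro ⟨s, hs, rfl⟩
    refine ⟨?_, fun b hb => hs ?_⟩
    · rw [hf_coe, Nat.lt_succ_iff]
      exact Finset.sum_le_sum_of_subset hs
    · rw [bitIndices_sum] at hb
      simpa using hb

theorem powIter_succ (t n : ℕ) : powIter t (n + 1) = powCode (powIter t n) := rfl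

theorem mkCode_instList {L : FinLang} {Φ : Finset (Fml L)} {l : List ℕ}
    (h : ∀ c, c ∈ l ↔ ∃ φ ∈ Φ, φ.code = c) (p q : ℕ) :
    mkCode (instList l p q) = hf (instCodes Φ p q : Set ℕ) := by
  refine mkCode_eq fun a => ?_
  have hd : ∀ φ : Fml L, Denumerable.ofNat (ℕ × ℕ × ℕ) φ.code =
      (φ.p, φ.q, formulaCode (L.setsFunCode φ.p) (L.setsRelCode φ.p) φ.form) :=
    fun φ => Denumerable.ofNat_encode _
  simp only [instList, List.mem_flatMap, List.mem_map, Finset.mem_coe, instCodes,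
    Finset.mem_biUnion, Finset.mem_image, Finset.mem_univ, true_and, Prod.exists, instCode_eq, h]
  constructor
  · rintro ⟨_, ⟨φ, hφ, rfl⟩, L₁, h1, L₂, h2, rfl⟩
    rw [hd] at h1 h2
    obtain ⟨l, rfl⟩ := exists_ofFn_val_iff.2 h1
    obtain ⟨j, rfl⟩ := exists_ofFn_val_iff.2 h2
    exact ⟨φ, hφ, l, j, rfl⟩
  · rintro ⟨φ, hφ, l, j, rfl⟩
    refine ⟨_, ⟨φ, hφ, rfl⟩, _, ?_, _, ?_, rfl⟩
    · rw [hd]; exact exists_ofFn_val_iff.1 ⟨l, rfl⟩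
    · rw [hd]; exact exists_ofFn_val_iff.1 ⟨j, rfl⟩

theorem powIter_possth {L : FinLang} (Φ : Finset (Fml L)) (k : List ℕ) (p : ℕ) :
    powIter (hf (instCodes Φ p (seq k 0) : Set ℕ)) 1 = hf (possth Φ k p 0 (seq k 0) : Set ℕ) :=
  powCode_hf _

/-- Every layer of the recursion for the possible values is a power set: one for the atomic
theories, one for the element quantifier, and one for each of the `j` set quantifiers. Lower levels
have more sets available, but `p + k̄(1) + … + k̄(j)` stays constant along the recursion, so one set
of formal instances serves all levels. -/
theorem powIter_possTh {L : FinLang} (Φ : Finset (Fml L)) (k : List ℕ) (j p : ℕ) :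
    powIter (hf (instCodes Φ (p + setSum k j) (seq k 0) : Set ℕ)) (j + 2)
      = hf (possTh Φ k j p : Set ℕ) := by
  induction j generalizing p with
  | zero =>
    rw [possTh, possth, ← powCode_hf, Nat.zero_add (seq k 0), ← powIter_possth]
    rfl
  | succ j ih =>
    rw [possTh, ← powCode_hf, ← ih, ← powIter_succ]
    have h : p + setSum k (j + 1) = p + seq k (j + 1) + setSum k j := by
      change p + (setSum k j + seq k (j + 1)) = _
      omega
    rw [h]

/-- The data of a rule, as read from its code. -/
noncomputable def Rule.data (σ : Rule) : RuleData :=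
  (σ.L₁.fns, σ.L₁.rels, σ.L₂.fns, σ.L₂.rels, σ.L₃,
    List.ofFn fun R => hf (Cond.code '' (σ.cond R : Set (Cond σ.L₁ σ.L₂ (σ.L₃.get R)))))

theorem Rule.ofNat_code (σ : Rule) : Denumerable.ofNat RuleData σ.code = σ.data :=
  Denumerable.ofNat_encode σ.data

theorem Cond.ofNat_code {L₁ L₂ : FinLang} {n : ℕ} (τ : Cond L₁ L₂ n) :
    Denumerable.ofNat (ℕ × ℕ × ℕ) τ.code = (hf {c | ∃ l m : Fin n, τ.E l m ∧ c = Nat.pair l m},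
      hf (Inst.code '' (τ.Φ : Set (Inst L₁ n))), hf (Inst.code '' (τ.Ψ : Set (Inst L₂ n)))) :=
  Denumerable.ofNat_encode _

theorem Inst.ofNat_code {L : FinLang} {n : ℕ} (f : Inst L n) :
    Denumerable.ofNat (ℕ × ℕ × List ℕ) f.code =
      (f.q, L.code f.form, List.ofFn fun s => (f.v s : ℕ)) :=
  Denumerable.ofNat_encode (f.q, L.code f.form, List.ofFn fun s => (f.v s : ℕ))

theorem mem_bitIndices_hf_image {α : Type*} {A : Finset α} {f : α → ℕ} {c : ℕ} :
    c ∈ (hf (f '' (A : Set α))).bitIndices ↔ ∃ x ∈ A, f x = c :=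
  mem_bitIndices_hf (A.finite_toSet.image f)

theorem Rule.ofFormula_mem_Phi {σ : Rule} {R : Fin σ.L₃.length} {τ : Cond σ.L₁ σ.L₂ (σ.L₃.get R)}
    (hτ : τ ∈ σ.cond R) {f : Inst σ.L₁ (σ.L₃.get R)} (hf : f ∈ τ.Φ) :
    ofFormula f.form ∈ σ.Phi := by
  classical
  simp only [Rule.Phi, Finset.mem_union, Finset.mem_biUnion, Finset.mem_image]
  exact Or.inl ⟨R, Finset.mem_univ _, τ, hτ, f, hf, rfl⟩

theorem Rule.ofFormula_mem_Psi {σ : Rule} {R : Fin σ.L₃.length} {τ : Cond σ.L₁ σ.L₂ (σ.L₃.get R)}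
    (hτ : τ ∈ σ.cond R) {f : Inst σ.L₂ (σ.L₃.get R)} (hf : f ∈ τ.Ψ) :
    ofFormula f.form ∈ σ.Psi := by
  classical
  simp only [Rule.Psi, Finset.mem_union, Finset.mem_biUnion, Finset.mem_image]
  exact Or.inl ⟨R, Finset.mem_univ _, τ, hτ, f, hf, rfl⟩

theorem Rule.eqFml_mem_Phi (σ : Rule) : eqFml σ.L₁ ∈ σ.Phi := by simp [Rule.Phi]

theorem Rule.memFml_mem_Phi (σ : Rule) : memFml σ.L₁ ∈ σ.Phi := by simp [Rule.Phi]

theorem Rule.eqFml_mem_Psi (σ : Rule) : eqFml σ.L₂ ∈ σ.Psi := by simp [Rule.Psi]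

theorem Rule.memFml_mem_Psi (σ : Rule) : memFml σ.L₂ ∈ σ.Psi := by simp [Rule.Psi]

theorem Rule.mem_phiCodes (σ : Rule) (c : ℕ) :
    c ∈ phiCodes σ.data ↔ ∃ φ ∈ σ.Phi, φ.code = c := by
  classical
  simp only [phiCodes, Rule.data, List.mem_cons, List.mem_flatMap, List.mem_ofFn, List.mem_map]
  constructor
  · rintro (rfl | rfl | ⟨_, ⟨R, rfl⟩, t, ht, g, hg, rfl⟩)
    · exact ⟨_, σ.eqFml_mem_Phi, rfl⟩
    · exact ⟨_, σ.memFml_mem_Phi, rfl⟩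
    · obtain ⟨τ, hτ, rfl⟩ := mem_bitIndices_hf_image.1 ht
      rw [Cond.ofNat_code] at hg
      obtain ⟨f, hf, rfl⟩ := mem_bitIndices_hf_image.1 hg
      rw [Inst.ofNat_code]
      exact ⟨_, Rule.ofFormula_mem_Phi hτ hf, code_ofFormula _⟩
  · rintro ⟨φ, hφ, rfl⟩
    simp only [Rule.Phi, Finset.mem_union, Finset.mem_biUnion, Finset.mem_image,
      Finset.mem_insert, Finset.mem_singleton] at hφ
    rcases hφ with ⟨R, -, τ, hτ, f, hf, rfl⟩ | rfl | rfl
    · refine Or.inr (Or.inr ⟨_, ⟨R, rfl⟩, _, mem_bitIndices_hf_image.2 ⟨τ, hτ, rfl⟩, f.code, ?_, ?_⟩)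
      · rw [Cond.ofNat_code]
        exact mem_bitIndices_hf_image.2 ⟨f, hf, rfl⟩
      · rw [Inst.ofNat_code, code_ofFormula]
    · exact Or.inl rfl
    · exact Or.inr (Or.inl rfl)

/-! ### Atomic theories of tuples of a generalized sum -/

theorem getD_ofFn {α : Type*} {n : ℕ} (f : Fin n → α) (d : α) (i : Fin n) :
    (List.ofFn f).getD i d = f i := by
  simp [List.getD_eq_getElem?_getD]

/-- The predicate with index `i` of a finite relational language. -/
def relSymb {A : List ℕ} (i : Fin A.length) : (relLang A).lang.Relations (A.get i) := ⟨i, rfl⟩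

/-- The atomic formula `R(x_0, x_1, …)` for the predicate `R` with index `i`. -/
def atomFml {A : List ℕ} (i : Fin A.length) : Fml (relLang A) :=
  ofFormula (Relations.formula (relSymb i) fun j => var j)

theorem code_atomFml {A : List ℕ} (i : Fin A.length) :
    (atomFml i).code = atomCode i (A.get i) := by
  rw [atomFml, code_ofFormula, atomCode]
  have h : (relLang A).code (Relations.formula (relSymb i) fun j => var j) =
      Nat.pair 2 (Nat.pair (2 * i)
        (Encodable.encode (List.ofFn fun j : Fin (A.get i) => Nat.pair 0 j))) := rfl
  rw [h]
  congr 6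
  apply List.ext_getElem <;> simp

theorem mem_atomic {A : List ℕ} {φ : Fml (relLang A)} :
    φ ∈ atomic A ↔ (∃ i, atomFml i = φ) ∨ φ = eqFml _ ∨ φ = memFml _ := by
  classical
  simp only [atomic, Finset.mem_union, Finset.mem_image, Finset.mem_univ, true_and,
    Finset.mem_insert, Finset.mem_singleton]
  rfl

theorem holds_atomFml {A : List ℕ} {M : Type u} [(relLang A).lang.Structure M] (i : Fin A.length)
    (P : Fin (atomFml i).p → Set M) (a : Fin (atomFml i).q → M) :
    (atomFml i).Holds P a ↔ FirstOrder.Language.Structure.RelMap (relSymb i) a :=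
  (holds_ofFormula _ P a).trans Formula.realize_rel

/-- The coordinatewise union of sequences of sets. -/
def unionSets {N : Type u} {M : N → Type v} (Q : List (∀ i, Set (M i))) : List (Set (Σ i, M i)) :=
  Q.map fun Q => {x | x.2 ∈ Q x.1}

section
variable {σ : Rule} {N : Type u} [σ.L₂.lang.Structure N] {M : N → Type v}
  [∀ i, σ.L₁.lang.Structure (M i)] {k r : List ℕ} {Y : List (Set N)} {Q : List (∀ i, Set (M i))}
  {K : ℕ} {b : List N} {β : Fin K → Σ i, M i} {α : ∀ e : Fin K, List (M (β e).1)}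

/-- The tuple `α e` lives in the summand of `β e` and agrees with `β` at all positions lying in that
summand; this is `hβ`, phrased in the sigma type to avoid transport between summands. Then `E` and
`Ψ` are decided by the index theory, and each formula of `Φ` by the theory of a single `α e`. -/
theorem satCond_iff (hK : K ≤ b.length) (hb : ∀ e : Fin K, b[e] = (β e).1)
    (hα : ∀ e, (α e).length = K)
    (hβ : ∀ e e' : Fin K, (β e').1 = (β e).1 →
      (⟨(β e).1, (α e)[e']'((hα e).symm ▸ e'.2)⟩ : Σ i, M i) = β e')
    {R : Fin σ.L₃.length} {τ : Cond σ.L₁ σ.L₂ (σ.L₃.get R)} (hτ : τ ∈ σ.cond R)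
    (j : Fin (σ.L₃.get R) → Fin K) :
    Param.satCond (th σ.Psi r Y 0 b)
      (List.ofFn fun e => th σ.Phi k (Q.map fun Q => Q (β e).1) 0 (α e)) (σ.L₃.get R)
      (List.ofFn fun l => (j l : ℕ)) τ.code = true ↔ τ.Sat fun l => β (j l) := by
  have hmap : ∀ {q : ℕ} (v : Fin q → Fin (σ.L₃.get R)),
      ((List.ofFn fun s => (v s : ℕ)).map fun v => (List.ofFn fun l => (j l : ℕ)).getD v 0) =
        List.ofFn fun s => (j (v s) : ℕ) := by
    intro q v
    rw [List.map_ofFn]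
    congr 1
    funext s
    exact getD_ofFn _ _ _
  have hE : ((∀ l < σ.L₃.get R, ∀ m < σ.L₃.get R,
      Param.holdsEq (th σ.Psi r Y 0 b) ((List.ofFn fun l => (j l : ℕ)).getD l 0)
        ((List.ofFn fun l => (j l : ℕ)).getD m 0) =
      (hf {c | ∃ l m : Fin (σ.L₃.get R), τ.E l m ∧ c = Nat.pair l m}).testBit (Nat.pair l m))) ↔
      ∀ l m, (β (j l)).1 = (β (j m)).1 ↔ τ.E l m := by
    have hfin : {c | ∃ l m : Fin (σ.L₃.get R), τ.E l m ∧ c = Nat.pair l m}.Finite := by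
      refine (Set.finite_range fun p : Fin (σ.L₃.get R) × Fin (σ.L₃.get R) =>
        Nat.pair p.1 p.2).subset ?_
      rintro c ⟨l, m, -, rfl⟩
      exact ⟨(l, m), rfl⟩
    have h : ∀ l m : Fin (σ.L₃.get R),
        (Param.holdsEq (th σ.Psi r Y 0 b) ((List.ofFn fun l => (j l : ℕ)).getD l 0)
          ((List.ofFn fun l => (j l : ℕ)).getD m 0) =
        (hf {c | ∃ l m : Fin (σ.L₃.get R), τ.E l m ∧ c = Nat.pair l m}).testBit (Nat.pair l m)) ↔
        ((β (j l)).1 = (β (j m)).1 ↔ τ.E l m) := by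
      intro l m
      rw [getD_ofFn, getD_ofFn, Bool.eq_iff_iff, holdsEq_th σ.eqFml_mem_Psi, testBit_hf hfin]
      refine iff_congr ?_ ?_
      · rw [← hb, ← hb]
        exact ⟨fun ⟨_, _, h⟩ => h, fun h => ⟨(j l).2.trans_le hK, (j m).2.trans_le hK, h⟩⟩
      · constructor
        · rintro ⟨l', m', h, h'⟩
          obtain ⟨h1, h2⟩ := Nat.pair_eq_pair.1 h'
          rwa [Fin.ext h1, Fin.ext h2]
        · exact fun h => ⟨l, m, h, rfl⟩
    exact ⟨fun H l m => (h l m).1 (H l l.2 m m.2), fun H l hl m hm => (h ⟨l, hl⟩ ⟨m, hm⟩).2 (H _ _)⟩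
  have hΨ : (∀ c ∈ (hf (Inst.code '' (τ.Ψ : Set (Inst σ.L₂ (σ.L₃.get R))))).bitIndices,
      (th σ.Psi r Y 0 b).testBit
        (inst (Encodable.encode (0, (Denumerable.ofNat (ℕ × ℕ × List ℕ) c).1,
        (Denumerable.ofNat (ℕ × ℕ × List ℕ) c).2.1)) []
        ((Denumerable.ofNat (ℕ × ℕ × List ℕ) c).2.2.map fun v =>
          (List.ofFn fun l => (j l : ℕ)).getD v 0)) = true) ↔
      ∀ g ∈ τ.Ψ, g.form.Realize fun s => (β (j (g.v s))).1 := by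
    simp only [mem_bitIndices_hf_image, forall_exists_index, and_imp, forall_apply_eq_imp_iff₂]
    refine forall₂_congr fun g hg => ?_
    rw [Inst.ofNat_code, hmap, testBit_th_ofFormula (Rule.ofFormula_mem_Psi hτ hg)]
    have h : (fun s => (β (j (g.v s))).1) = fun s => b[j (g.v s)] := funext fun s => (hb _).symm
    rw [h]
    exact ⟨fun ⟨_, h⟩ => h, fun h => ⟨fun s => (j (g.v s)).2.trans_le hK, h⟩⟩
  -- Only once `E` is known to describe the coincidences of indices do the variables of a formula of
  -- `Φ` lie in one summand, so the equivalence is conditional on that.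
  have hΦ : (∀ l m, (β (j l)).1 = (β (j m)).1 ↔ τ.E l m) →
      ((∀ c ∈ (hf (Inst.code '' (τ.Φ : Set (Inst σ.L₁ (σ.L₃.get R))))).bitIndices,
      ((List.ofFn fun e => th σ.Phi k (Q.map fun Q => Q (β e).1) 0 (α e)).getD
        ((List.ofFn fun l => (j l : ℕ)).getD
          (Denumerable.ofNat (ℕ × ℕ × List ℕ) c).2.2.headI 0) 0).testBit
        (inst (Encodable.encode (0, (Denumerable.ofNat (ℕ × ℕ × List ℕ) c).1,
        (Denumerable.ofNat (ℕ × ℕ × List ℕ) c).2.1)) []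
        ((Denumerable.ofNat (ℕ × ℕ × List ℕ) c).2.2.map fun v =>
          (List.ofFn fun l => (j l : ℕ)).getD v 0)) = true) ↔
      ∀ f ∈ τ.Φ, ∃ (i : N) (a : Fin f.q → M i), (∀ s, β (j (f.v s)) = ⟨i, a s⟩) ∧
        f.form.Realize a) := by
    intro hE
    simp only [mem_bitIndices_hf_image, forall_exists_index, and_imp, forall_apply_eq_imp_iff₂]
    refine forall₂_congr fun f hf => ?_
    rw [Inst.ofNat_code]
    -- Since `0 < f.q`, the head is a genuine variable and not the default value; it selects the
    -- summand in which `f` is evaluated.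
    have hv : (List.ofFn fun s => (f.v s : ℕ)).headI = f.v ⟨0, τ.pos f hf⟩ := by
      rw [← List.getI_zero_eq_headI]
      exact getD_ofFn (fun s => (f.v s : ℕ)) default ⟨0, τ.pos f hf⟩
    dsimp only
    rw [hv, hmap, getD_ofFn, getD_ofFn, testBit_th_ofFormula (Rule.ofFormula_mem_Phi hτ hf)]
    set e := j (f.v ⟨0, τ.pos f hf⟩) with he
    have hs : ∀ s, (⟨(β e).1, (α e)[j (f.v s)]'((hα e).symm ▸ (j (f.v s)).2)⟩ : Σ i, M i) =
        β (j (f.v s)) := fun s => hβ _ _ ((hE _ _).2 (τ.equiv f hf _ _))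
    constructor
    · rintro ⟨h1, h2⟩
      exact ⟨(β e).1, _, fun s => (hs s).symm, h2⟩
    · rintro ⟨i, a, h1, h2⟩
      refine ⟨fun s => (hα e).symm ▸ (j (f.v s)).2, ?_⟩
      obtain rfl : (β e).1 = i := by rw [he, h1]
      have h3 : a = fun s => (α e)[j (f.v s)]'((hα e).symm ▸ (j (f.v s)).2) := by
        funext s
        exact (eq_of_heq (Sigma.mk.inj ((hs s).trans (h1 s))).2).symm
      rw [h3] at h2
      exact h2
  rw [Param.satCond, Cond.ofNat_code]
  simp only [Bool.and_eq_true, List.all_eq_true, List.mem_range, beq_iff_eq]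
  rw [hE, hΨ, and_assoc, Cond.Sat]
  refine and_congr_right fun h => ?_
  rw [hΦ h]

/-- A relation holds through one of its conditions, which `satCond_iff` decides. Two elements are
equal iff their indices are equal and they are equal inside the common summand. Membership in a
union of sets is decided in the summand of the element. -/
theorem comp_eq_th {n A : ℕ} (hK : K ≤ b.length) (hb : ∀ e : Fin K, b[e] = (β e).1)
    (hα : ∀ e, (α e).length = K)
    (hβ : ∀ e e' : Fin K, (β e').1 = (β e).1 →
      (⟨(β e).1, (α e)[e']'((hα e).symm ▸ e'.2)⟩ : Σ i, M i) = β e') :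
    Param.comp (σ.data, n, K, A) Q.length (th σ.Psi r Y 0 b)
      (List.ofFn fun e => th σ.Phi k (Q.map fun Q => Q (β e).1) 0 (α e)) =
    letI := σ.sumStructure N M
    th (atomic σ.L₃) k (unionSets Q) 0 (List.ofFn β) := by
  let := σ.sumStructure N M
  conv_rhs => rw [th]
  refine mkCode_eq fun c => ?_
  rw [List.mem_append, List.mem_append, Set.mem_ofPred_eq, or_assoc]
  have h1 : ∀ R : Fin σ.L₃.length, σ.data.2.2.2.2.1.getD R 0 = σ.L₃.get R := by
    intro R
    simp [Rule.data]
  have h2 : ∀ R : Fin σ.L₃.length, σ.data.2.2.2.2.2.getD R 0 =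
    hf (Cond.code '' (σ.cond R : Set (Cond σ.L₁ σ.L₂ (σ.L₃.get R)))) := fun R => getD_ofFn _ _ _
  have hα' : ∀ (e : Fin K) (h : (e : ℕ) < (α e).length),
      (⟨(β e).1, (α e)[(e : ℕ)]⟩ : Σ i, M i) = β e := fun e _ => hβ e e rfl
  have h3 : ∀ e : Fin K, (β e).2 = (α e)[(e : ℕ)]'((hα e).symm ▸ e.2) := by
    intro e
    have := hα' e ((hα e).symm ▸ e.2)
    exact (eq_of_heq (Sigma.mk.inj this).2).symm
  constructor
  · rintro (h | h | h)
    · simp only [List.mem_flatMap, List.mem_range, List.mem_map, List.mem_filter,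
        List.any_eq_true] at h
      obtain ⟨i, hi, J, ⟨hJ, t, ht, hs⟩, rfl⟩ := h
      obtain ⟨R, rfl⟩ : ∃ R : Fin σ.L₃.length, i = R := ⟨⟨i, hi⟩, rfl⟩
      rw [h1] at hs hJ ⊢
      rw [h2] at ht
      obtain ⟨j, rfl⟩ := exists_ofFn_val_iff.2 hJ
      obtain ⟨τ, hτ, rfl⟩ := mem_bitIndices_hf_image.1 ht
      rw [satCond_iff hK hb hα hβ hτ] at hs
      refine ⟨_, mem_atomic.2 (Or.inl ⟨R, rfl⟩), Fin.elim0, fun l => Fin.cast (by simp) (j l), ?_, ?_⟩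
      · rw [holds_atomFml]
        refine ⟨τ, hτ, ?_⟩
        have h' : τ.Sat fun l => (List.ofFn β).get (Fin.cast (by simp) (j l)) := by
          simp only [List.get_ofFn]
          exact hs
        exact h'
      · rw [← code_atomFml]
        rfl
    · simp only [List.mem_flatMap, List.mem_range, List.mem_map, List.mem_filter,
        Bool.and_eq_true] at h
      obtain ⟨e, he, e', ⟨he', hs, hs'⟩, rfl⟩ := h
      obtain ⟨e, rfl⟩ : ∃ R : Fin K, e = R := ⟨⟨e, he⟩, rfl⟩
      obtain ⟨e', rfl⟩ : ∃ R : Fin K, e' = R := ⟨⟨e', he'⟩, rfl⟩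
      rw [getD_ofFn, holdsEq_th σ.eqFml_mem_Phi] at hs'
      rw [holdsEq_th σ.eqFml_mem_Psi] at hs
      obtain ⟨_, _, hs⟩ := hs
      obtain ⟨_, _, hs'⟩ := hs'
      have hee : β e = β e' := by
        refine (hα' e ((hα e).symm ▸ e.2)).symm.trans (Eq.trans ?_
          (hβ e e' ((hb e').symm.trans (hs.symm.trans (hb e)))))
        exact congrArg _ hs'
      refine ⟨_, mem_atomic.2 (Or.inr (Or.inl rfl)), Fin.elim0,
        fun l => Fin.cast (by simp) (![e, e'] l), ?_, rfl⟩
      rw [holds_eqFml]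
      simpa using hee
    · simp only [List.mem_flatMap, List.mem_range, List.mem_map, List.mem_filter] at h
      obtain ⟨e, he, l, ⟨hl, hs⟩, rfl⟩ := h
      obtain ⟨e, rfl⟩ : ∃ R : Fin K, e = R := ⟨⟨e, he⟩, rfl⟩
      rw [getD_ofFn, holdsMem_th σ.memFml_mem_Phi] at hs
      obtain ⟨_, _, hs⟩ := hs
      refine ⟨_, mem_atomic.2 (Or.inr (Or.inr rfl)), fun _ => ⟨l, by simpa [unionSets] using hl⟩,
        fun _ => Fin.cast (by simp) e, ?_, rfl⟩
      rw [holds_memFml]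
      simpa [unionSets, h3] using hs
  · rintro ⟨φ, hφ, l, j, h, rfl⟩
    rcases mem_atomic.1 hφ with ⟨R, rfl⟩ | rfl | rfl
    · rw [holds_atomFml] at h
      obtain ⟨τ, hτ, h⟩ := h
      left
      simp only [List.mem_flatMap, List.mem_range, List.mem_map, List.mem_filter,
        List.any_eq_true]
      refine ⟨R, R.2, List.ofFn fun s => (j s : ℕ), ⟨?_, τ.code, ?_, ?_⟩, ?_⟩
      · rw [h1]
        exact exists_ofFn_val_iff.1 ⟨fun l => Fin.cast (by simp) (j l), rfl⟩
      · rw [h2]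
        exact mem_bitIndices_hf_image.2 ⟨τ, hτ, rfl⟩
      · rw [h1]
        refine (satCond_iff hK hb hα hβ hτ fun l => Fin.cast (by simp) (j l)).2 ?_
        have h' : τ.Sat fun l => (List.ofFn β).get (j l) := h
        simpa only [List.get_ofFn] using h'
      · rw [h1, instCode_eq, code_atomFml]
        rfl
    · rw [holds_eqFml] at h
      right; left
      simp only [List.mem_flatMap, List.mem_range, List.mem_map, List.mem_filter,
        Bool.and_eq_true]
      obtain ⟨e, he⟩ : ∃ e : Fin K, e = Fin.cast (by simp) (j (0 : Fin 2)) := ⟨_, rfl⟩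
      obtain ⟨e', he'⟩ : ∃ e : Fin K, e = Fin.cast (by simp) (j (1 : Fin 2)) := ⟨_, rfl⟩
      have hee : β e = β e' := by
        rw [he, he']
        simpa only [List.get_ofFn] using h
      refine ⟨e, e.2, e', ⟨e'.2, ?_, ?_⟩, ?_⟩
      · rw [holdsEq_th σ.eqFml_mem_Psi]
        exact ⟨e.2.trans_le hK, e'.2.trans_le hK,
          (hb e).trans ((congrArg Sigma.fst hee).trans (hb e').symm)⟩
      · rw [getD_ofFn, holdsEq_th σ.eqFml_mem_Phi]
        refine ⟨(hα e).symm ▸ e.2, (hα e).symm ▸ e'.2, ?_⟩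
        have := (hβ e e' (congrArg Sigma.fst hee).symm).trans
          (hee.symm.trans (hα' e ((hα e).symm ▸ e.2)).symm)
        exact (eq_of_heq (Sigma.mk.inj this).2).symm
      · rw [he, he']
        rfl
    · rw [holds_memFml] at h
      right; right
      simp only [List.mem_flatMap, List.mem_range, List.mem_map, List.mem_filter]
      obtain ⟨e, he⟩ : ∃ e : Fin K, e = Fin.cast (by simp) (j (0 : Fin 1)) := ⟨_, rfl⟩
      have hl : (l (0 : Fin 1) : ℕ) < Q.length := by
        simpa [unionSets] using (l (0 : Fin 1)).2
      refine ⟨e, e.2, l (0 : Fin 1), ⟨hl, ?_⟩, ?_⟩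
      · rw [getD_ofFn, holdsMem_th σ.memFml_mem_Phi]
        refine ⟨by simpa using hl, (hα e).symm ▸ e.2, ?_⟩
        rw [← h3, List.getElem_map]
        rw [List.get_ofFn, ← he] at h
        have h' : β e ∈ (unionSets Q)[(l (0 : Fin 1) : ℕ)]'(l (0 : Fin 1)).2 := h
        rw [show (unionSets Q)[(l (0 : Fin 1) : ℕ)]'(l (0 : Fin 1)).2 =
          {x | x.2 ∈ Q[(l (0 : Fin 1) : ℕ)] x.1} from List.getElem_map _] at h'
        exact h'
      · rw [he]
        rfl

end

/-! ### Families of type sets -/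

/-- The element `i` belongs to the set with index `s` of the list `Y`. -/
def MemAt {N : Type u} (Y : List (Set N)) (s : ℕ) (i : N) : Prop := ∃ h : s < Y.length, i ∈ Y[s]

theorem memAt_append_left {N : Type u} {Y Z : List (Set N)} {s : ℕ} {i : N} (h : s < Y.length) :
    MemAt (Y ++ Z) s i ↔ MemAt Y s i := by
  simp only [MemAt, List.getElem_append_left h, List.length_append]
  exact ⟨fun ⟨_, h'⟩ => ⟨h, h'⟩, fun ⟨_, h'⟩ => ⟨by omega, h'⟩⟩

theorem memAt_append_right {N : Type u} {Y Z : List (Set N)} {s : ℕ} {i : N} :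
    MemAt (Y ++ Z) (Y.length + s) i ↔ MemAt Z s i := by
  simp [MemAt]

theorem memAt_typeSets {N : Type u} {T : Finset ℕ} {t : N → ℕ} {s : ℕ} {i : N} :
    MemAt (typeSets T t) s i ↔ ∃ h : s < (T.sort (· ≤ ·)).length, t i = (T.sort (· ≤ ·))[s] := by
  simp only [MemAt, typeSets, List.getElem_map, List.length_map, Set.mem_ofPred_eq]

theorem length_typeSets {N : Type u} (T : Finset ℕ) (t : N → ℕ) :
    (typeSets T t).length = (T.sort (· ≤ ·)).length := List.length_map _

theorem holdsMem_th_iff {L : FinLang} {M : Type u} [L.lang.Structure M] {Φ : Finset (Fml L)}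
    {k : List ℕ} {P : List (Set M)} (hΦ : memFml L ∈ Φ) {a : List M} {s e : ℕ} (he : e < a.length) :
    Param.holdsMem (th Φ k P 0 a) s e = true ↔ MemAt P s a[e] := by
  rw [holdsMem_th hΦ]
  exact ⟨fun ⟨h1, _, h2⟩ => ⟨h1, h2⟩, fun ⟨h1, h2⟩ => ⟨h1, he, h2⟩⟩

/-- The sets of the indices `i` for which `(M i, P̄_i)` has a given theory. -/
noncomputable def thSets {L : FinLang} {N : Type u} {M : N → Type v} [∀ i, L.lang.Structure (M i)]
    (Φ : Finset (Fml L)) (k : List ℕ) (j : ℕ) (Q : List (∀ i, Set (M i))) : List (Set N) :=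
  typeSets (possTh Φ k j Q.length) fun i => Th Φ k j (Q.map fun Q => Q i)

theorem Th_mem_possTh_map {L : FinLang} {N : Type u} {M : N → Type v}
    [∀ i, L.lang.Structure (M i)] (Φ : Finset (Fml L)) (k : List ℕ) (j : ℕ)
    (Q : List (∀ i, Set (M i))) (i : N) :
    Th Φ k j (Q.map fun Q => Q i) ∈ possTh Φ k j Q.length := by
  have h := Th_mem_possTh Φ k j (Q.map fun Q => Q i)
  rwa [List.length_map] at h

theorem unionSets_append {N : Type u} {M : N → Type v} (Q W : List (∀ i, Set (M i))) :
    unionSets (Q ++ W) = unionSets Q ++ unionSets W := List.map_append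

/-- A subset of the disjoint union is the union of its slices, so quantifying over sets of the sum
amounts to quantifying over families of sets. -/
theorem exists_unionSets_eq {N : Type u} {M : N → Type v} (S : List (Set (Σ i, M i))) :
    ∃ W : List (∀ i, Set (M i)), W.length = S.length ∧ unionSets W = S := by
  refine ⟨S.map fun S i => {a | (⟨i, a⟩ : Σ i, M i) ∈ S}, List.length_map _, ?_⟩
  rw [unionSets, List.map_map]
  exact List.map_id _

/-! ### Position of the type sets, and descent to atomic theories -/

namespace Param

theorem types_mk {σ : Rule} {n m j p : ℕ} {k : List ℕ} (h : p + setSum k j = m + setSum k n) :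
    (Param.mk σ.data n m k).types j = (possTh σ.Phi k j p).sort (· ≤ ·) := by
  rw [← bitIndices_sum, ← hf_coe, ← powIter_possTh, h]
  change (powIter (mkCode _) (j + 2)).bitIndices = _
  rw [mkCode_instList σ.mem_phiCodes]

theorem total_mono (x : Param) : Monotone x.total :=
  monotone_nat_of_le_succ fun _ => Nat.le_add_right _ _

/-- Type sets are adjoined from level `n` downwards, so those of level `j` come right after those of
level `j + 1`. -/
theorem offset_eq (x : Param) {j : ℕ} (hj : j + 1 ≤ x.2.1) :
    x.offset j = x.offset (j + 1) + (x.types (j + 1)).length := by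
  have h1 : x.total (j + 1 + 1) = x.total (j + 1) + (x.types (j + 1)).length := rfl
  have h2 : x.total (j + 1 + 1) ≤ x.total (x.2.1 + 1) := x.total_mono (by omega)
  simp only [offset]
  omega

theorem offset_self (x : Param) : x.offset x.2.1 = 0 := Nat.sub_self _

theorem pick_succ (t j : ℕ) : pick t (j + 1) = pick t.bitIndices.headI j := by
  induction j with
  | zero => rfl
  | succ j ih =>
    change (pick t (j + 1)).bitIndices.headI = (pick t.bitIndices.headI j).bitIndices.headI
    rw [ih]

/-- Descending through arbitrary elements only appends unspecified sets `W` at the end of the list.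
Atomic facts about the sets in `P` survive, and all tuples of elements are still represented. -/
theorem exists_mem_bitIndices_pick {L : FinLang} {M : Type u} [L.lang.Structure M]
    (Φ : Finset (Fml L)) (r : List ℕ) (j : ℕ) (P : List (Set M)) :
    ∃ W : List (Set M), ∀ u, u ∈ (pick (Th Φ r j P) j).bitIndices ↔
      ∃ b : List M, b.length = seq r 0 ∧ u = th Φ r (P ++ W) 0 b := by
  induction j generalizing P with
  | zero =>
    refine ⟨[], fun u => ?_⟩
    rw [List.append_nil]
    exact mem_bitIndices_th_succ
  | succ j ih =>
    -- A theory above level 0 is never empty, even over the empty model: empty sets can always be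
    -- adjoined. So the head is an element and not a default value.
    have h : (Th Φ r (j + 1) P).bitIndices.headI ∈ (Th Φ r (j + 1) P).bitIndices := by
      have h1 : (Th Φ r (j + 1) P).bitIndices ≠ [] := List.ne_nil_of_mem
        (mem_bitIndices_Th_succ.2 ⟨List.replicate (seq r (j + 1)) ∅, List.length_replicate, rfl⟩)
      cases h2 : (Th Φ r (j + 1) P).bitIndices with
      | nil => exact absurd h2 h1
      | cons a l => exact List.mem_cons_self
    obtain ⟨Z, -, hZ⟩ := mem_bitIndices_Th_succ.1 h
    obtain ⟨W, hW⟩ := ih (P ++ Z)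
    refine ⟨Z ++ W, fun u => ?_⟩
    rw [pick_succ, hZ, hW, List.append_assoc]

/-! ### The bottom level -/

section
variable {σ : Rule} {N : Type u} [σ.L₂.lang.Structure N] {M : N → Type v}
  [∀ i, σ.L₁.lang.Structure (M i)] {n m j : ℕ} {k r : List ℕ} {X Z : List (Set N)}
  {Q : List (∀ i, Set (M i))}

/-- The type set containing `b[e]` reveals the level-0 theory of its summand, which is always among
the listed ones, and equality of indices is atomic. So both conditions are visible in the index
theory. -/
theorem choice_iff {b : List N} {s : Fin (seq k 0) → ℕ}
    (hX : X.length = (Param.mk σ.data n m k).offset 0) (hQ : Q.length = m + setSum k n)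
    (hb : seq k 0 ≤ b.length) :
    (Param.mk σ.data n m k).choice (th σ.Psi r (X ++ thSets σ.Phi k 0 Q) 0 b) (List.ofFn s) = true ↔
      ∀ e : Fin (seq k 0), s e ∈ (Th σ.Phi k 0 (Q.map fun Q => Q b[e])).bitIndices ∧
        ∀ e' : Fin (seq k 0), b[e] = b[e'] → s e = s e' := by
  have hT := types_mk (σ := σ) (j := 0) (p := Q.length) (n := n) (m := m) (k := k) hQ
  simp only [choice, List.all_eq_true, List.mem_range, Bool.and_eq_true, Bool.or_eq_true,
    Bool.not_eq_true', List.any_eq_true, beq_iff_eq]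
  have h1 : ∀ e : Fin (seq k 0), (∃ l < ((Param.mk σ.data n m k).types 0).length,
      holdsMem (th σ.Psi r (X ++ thSets σ.Phi k 0 Q) 0 b)
        ((Param.mk σ.data n m k).offset 0 + l) e = true ∧
      (((Param.mk σ.data n m k).types 0).getD l 0).testBit ((List.ofFn s).getD e 0) = true) ↔
      s e ∈ (Th σ.Phi k 0 (Q.map fun Q => Q b[e])).bitIndices := by
    intro e
    rw [hT]
    simp only [← hX, holdsMem_th_iff σ.memFml_mem_Psi (e.2.trans_le hb), memAt_append_right,
      thSets, memAt_typeSets, getD_ofFn, Nat.mem_bitIndices]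
    constructor
    · rintro ⟨l, hl, ⟨_, h⟩, h'⟩
      rw [List.getD_eq_getElem _ _ hl, ← h] at h'
      exact h'
    · intro h
      obtain ⟨l, hl, h'⟩ := List.getElem_of_mem
        ((Finset.mem_sort (· ≤ ·)).2 (Th_mem_possTh_map σ.Phi k 0 Q b[e]))
      refine ⟨l, hl, ⟨hl, h'.symm⟩, ?_⟩
      rw [List.getD_eq_getElem _ _ hl, h']
      exact h
  have h2 : ∀ e e' : Fin (seq k 0),
      (holdsEq (th σ.Psi r (X ++ thSets σ.Phi k 0 Q) 0 b) e e' = false ∨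
        (List.ofFn s).getD e 0 = (List.ofFn s).getD e' 0) ↔ (b[e] = b[e'] → s e = s e') := by
    intro e e'
    rw [getD_ofFn, getD_ofFn, ← Bool.not_eq_true, holdsEq_th σ.eqFml_mem_Psi, ← imp_iff_not_or]
    refine imp_congr_left ⟨fun ⟨_, _, h⟩ => h, fun h => ⟨e.2.trans_le hb, e'.2.trans_le hb, h⟩⟩
  constructor
  · exact fun h e => ⟨(h1 e).1 (h e e.2).1, fun e' => (h2 e e').1 ((h e e.2).2 e' e'.2)⟩
  · exact fun h e he => ⟨(h1 ⟨e, he⟩).2 (h _).1, fun e' he' => (h2 ⟨e, he⟩ ⟨e', he'⟩).2 ((h _).2 _)⟩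

/-- Admissible choices of theories are realized by tuples in the summands, whose entries at their
own positions form a tuple of the sum. Conversely, a tuple of the sum is completed to one
full-length tuple in each summand it meets. `comp_eq_th` identifies the atomic theories in both
directions. -/
theorem sumTh0_eq (hX : X.length = (Param.mk σ.data n m k).offset 0)
    (hQ : Q.length = m + setSum k n) (hk : 1 ≤ seq k 0) (hr : seq k 0 ≤ seq r 0) :
    (Param.mk σ.data n m k).sumTh0 (m + setSum k n) (Th σ.Psi r 0 (X ++ thSets σ.Phi k 0 Q)) =
      letI := σ.sumStructure N M
      Th (atomic σ.L₃) k 0 (unionSets Q) := by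
  let := σ.sumStructure N M
  have hTh : Th (atomic σ.L₃) k 0 (unionSets Q) = hf {c | ∃ b : List (Σ i, M i),
      b.length = seq k 0 ∧ c = th (atomic σ.L₃) k (unionSets Q) 0 ([] ++ b)} := rfl
  have hTh' : Th σ.Psi r 0 (X ++ thSets σ.Phi k 0 Q) = th σ.Psi r (X ++ thSets σ.Phi k 0 Q) 1 [] :=
    rfl
  have hTh1 : ∀ i, Th σ.Phi k 0 (Q.map fun Q => Q i) = th σ.Phi k (Q.map fun Q => Q i) 1 [] :=
    fun _ => rfl
  have hA : ∀ (e : N) (a : List (M e)), a.length = seq k 0 →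
      th σ.Phi k (Q.map fun Q => Q e) 0 a ∈
        (powIter (Param.mk σ.data n m k).2.2.2 1).bitIndices := by
    intro e a ha
    change _ ∈ (powIter (mkCode _) 1).bitIndices
    rw [mkCode_instList σ.mem_phiCodes, powIter_possth, mem_bitIndices_hf (Finset.finite_toSet _)]
    have h := th_mem_possth σ.Phi k (Q.map fun Q => Q e) 0 a
    rwa [List.length_map, ha, hQ] at h
  rw [hTh, hTh']
  refine mkCode_eq fun c => ?_
  simp only [List.mem_flatMap, mem_bitIndices_th_succ, List.mem_map, List.mem_filter,
    List.nil_append, Set.mem_ofPred_eq, mem_listsOf]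
  constructor
  · rintro ⟨_, ⟨b, hb, rfl⟩, s, ⟨⟨hs, -⟩, h⟩, rfl⟩
    obtain ⟨s, rfl⟩ : ∃ s' : Fin (seq k 0) → ℕ, List.ofFn s' = s := by
      change s.length = seq k 0 at hs
      rw [← hs]
      exact ⟨s.get, List.ofFn_get s⟩
    have hb' : seq k 0 ≤ b.length := hr.trans hb.ge
    rw [choice_iff hX hQ hb'] at h
    -- The realizing tuple is chosen as a function of the index and the theory alone. Positions with
    -- equal indices, hence equal theories, then share one tuple, which is the compatibility
    -- required by `comp_eq_th`.
    have h1 : ∀ (i : N) (v : ℕ), v ∈ (Th σ.Phi k 0 (Q.map fun Q => Q i)).bitIndices →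
        ∃ a : List (M i), a.length = seq k 0 ∧ v = th σ.Phi k (Q.map fun Q => Q i) 0 a :=
      fun i v hv => mem_bitIndices_th_succ.1 hv
    choose a ha ha' using h1
    have h2 : ∀ (e' : Fin (seq k 0)) (i i' : N) (v v' : ℕ) (h : _) (h' : _), i = i' → v = v' →
        (⟨i, (a i v h)[e']'(e'.2.trans_eq (ha i v h).symm)⟩ : Σ i, M i) =
          ⟨i', (a i' v' h')[e']'(e'.2.trans_eq (ha i' v' h').symm)⟩ := by
      rintro e' i _ v _ h h' rfl rfl
      rfl
    refine ⟨List.ofFn fun e => ⟨b[e], (a b[e] (s e) (h e).1)[e]'(e.2.trans_eq (ha _ _ (h e).1).symm)⟩,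
      List.length_ofFn, ?_⟩
    have h3 := comp_eq_th (σ := σ) (N := N) (M := M) (k := k) (r := r)
      (Y := X ++ thSets σ.Phi k 0 Q) (Q := Q) (K := seq k 0) (b := b) (n := n)
      (A := (Param.mk σ.data n m k).2.2.2)
      (β := fun e => ⟨b[e], (a b[e] (s e) (h e).1)[e]'(e.2.trans_eq (ha _ _ (h e).1).symm)⟩)
      (α := fun e => a b[e] (s e) (h e).1) hb' (fun _ => rfl) (fun e => ha _ _ _)
      (fun e e' hee => h2 e' _ _ _ _ _ _ hee.symm ((h e).2 e' hee.symm))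
    rw [← h3, ← hQ]
    congr 2
    funext e
    exact ha' _ _ _
  · rintro ⟨b, hb, rfl⟩
    obtain ⟨β, rfl⟩ : ∃ β : Fin (seq k 0) → Σ i, M i, List.ofFn β = b := by
      rw [← hb]
      exact ⟨b.get, List.ofFn_get b⟩
    classical
    -- The tuple depends only on the summand: it keeps the entries of `β` lying there and fills the
    -- other positions with an arbitrary element.
    let g : ∀ i, Nonempty (M i) → List (M i) := fun i hi => List.ofFn fun e : Fin (seq k 0) =>
      if h : (β e).1 = i then cast (congrArg M h) (β e).2 else hi.some
    let α : ∀ e : Fin (seq k 0), List (M (β e).1) := fun e => g _ ⟨(β e).2⟩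
    have hα : ∀ e, (α e).length = seq k 0 := fun e => List.length_ofFn
    have hcast : ∀ (i : N) (y : Σ i, M i) (h : y.1 = i), (⟨i, cast (congrArg M h) y.2⟩ : Σ i, M i) = y := by
      rintro _ y rfl
      rfl
    have hβ : ∀ e e' : Fin (seq k 0), (β e').1 = (β e).1 →
        (⟨(β e).1, (α e)[e']'(e'.2.trans_eq (hα e).symm)⟩ : Σ i, M i) = β e' := by
      intro e e' h
      simp only [α, g, Fin.getElem_fin, List.getElem_ofFn, Fin.eta, dif_pos h]
      exact hcast _ _ h
    -- Index tuples have length `r̄(0) ≥ k̄(0)`; the surplus positions repeat the first index, which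
    -- exists because `k̄(0) ≥ 1`, and are ignored by the algorithm.
    let b := (List.ofFn fun e => (β e).1) ++ List.replicate (seq r 0 - seq k 0) (β ⟨0, hk⟩).1
    have hbl : b.length = seq r 0 := by
      simp only [b, List.length_append, List.length_ofFn, List.length_replicate]
      omega
    have hbK : seq k 0 ≤ b.length := hr.trans hbl.ge
    have hbe : ∀ e : Fin (seq k 0), b[e] = (β e).1 := by
      intro e
      simp [b, List.getElem_append_left]
    refine ⟨_, ⟨b, hbl, rfl⟩, List.ofFn fun e => th σ.Phi k (Q.map fun Q => Q (β e).1) 0 (α e),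
      ⟨⟨List.length_ofFn, ?_⟩, ?_⟩, ?_⟩
    · intro y hy
      obtain ⟨e, rfl⟩ := List.mem_ofFn.1 hy
      exact hA _ _ (hα e)
    · rw [choice_iff hX hQ hbK]
      refine fun e => ⟨?_, fun e' hee => ?_⟩
      · rw [hbe, hTh1, mem_bitIndices_th_succ]
        exact ⟨α e, hα e, rfl⟩
      · rw [hbe, hbe] at hee
        have h2 : ∀ (i i' : N) (h : Nonempty (M i)) (h' : Nonempty (M i')), i = i' →
            th σ.Phi k (Q.map fun Q => Q i) 0 (g i h) =
              th σ.Phi k (Q.map fun Q => Q i') 0 (g i' h') := by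
          rintro i _ h h' rfl
          rfl
        exact h2 _ _ _ _ hee
    · rw [← hQ]
      exact comp_eq_th hbK hbe hα hβ

end

end Param

/-! ### Valid refinements and the induction on the level -/

namespace Param

section
variable {σ : Rule} {N : Type u} [σ.L₂.lang.Structure N] {M : N → Type v}
  [∀ i, σ.L₁.lang.Structure (M i)] {n m j : ℕ} {k r : List ℕ} {X Z : List (Set N)}
  {Q : List (∀ i, Set (M i))}

theorem setSum_succ (k : List ℕ) (j : ℕ) : setSum k (j + 1) = setSum k j + seq k (j + 1) := rfl

/-- The offsets locate the sets of levels `j` and `j + 1` in the list, independently of the appended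
`W`. Membership of the first entry in a set of level `j + 1` reveals the theory of its summand at
that level. -/
theorem validAt_iff (hX : X.length = (Param.mk σ.data n m k).offset (j + 1)) (hj : j + 1 ≤ n)
    (hQ : Q.length + setSum k (j + 1) = m + setSum k n)
    (hZ : Z.length = ((Param.mk σ.data n m k).types j).length) {W : List (Set N)} {b : List N}
    (hb : 0 < b.length) :
    (Param.mk σ.data n m k).validAt j
        (th σ.Psi r (X ++ thSets σ.Phi k (j + 1) Q ++ Z ++ W) 0 b) = true ↔
      ∃ l, ∃ hl : l < ((Param.mk σ.data n m k).types j).length,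
        MemAt Z l b[0] ∧ (∀ l', MemAt Z l' b[0] → l' = l) ∧
        ((Param.mk σ.data n m k).types j)[l] ∈
          (Th σ.Phi k (j + 1) (Q.map fun Q => Q b[0])).bitIndices := by
  have hT := types_mk (σ := σ) (j := j + 1) (p := Q.length) (n := n) (m := m) (k := k) hQ
  set x := Param.mk σ.data n m k with hx
  have hY : (X ++ thSets σ.Phi k (j + 1) Q).length = x.offset j := by
    rw [List.length_append, hX, thSets, length_typeSets, ← hT, ← x.offset_eq hj]
  have h1 : ∀ l < (x.types j).length, holdsMem
      (th σ.Psi r (X ++ thSets σ.Phi k (j + 1) Q ++ Z ++ W) 0 b) (x.offset j + l) 0 = true ↔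
      MemAt Z l b[0] := by
    intro l hl
    rw [holdsMem_th_iff σ.memFml_mem_Psi hb, List.append_assoc, ← hY, memAt_append_right,
      memAt_append_left (hl.trans_eq hZ.symm)]
  have h2 : ∀ l < (x.types (j + 1)).length, holdsMem
      (th σ.Psi r (X ++ thSets σ.Phi k (j + 1) Q ++ Z ++ W) 0 b) (x.offset (j + 1) + l) 0 = true ↔
      ∃ h : l < (x.types (j + 1)).length,
        Th σ.Phi k (j + 1) (Q.map fun Q => Q b[0]) = (x.types (j + 1))[l] := by
    intro l hl
    rw [holdsMem_th_iff σ.memFml_mem_Psi hb, List.append_assoc, List.append_assoc, ← hX,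
      memAt_append_right, memAt_append_left (by rwa [thSets, length_typeSets, ← hT]), thSets,
      memAt_typeSets]
    simp only [hT]
  simp only [validAt, List.any_eq_true, List.all_eq_true, List.mem_range, Bool.and_eq_true,
    Bool.or_eq_true, Bool.not_eq_true', beq_iff_eq]
  refine exists_congr fun l => ?_
  constructor
  · rintro ⟨hl, ⟨h3, h4⟩, l', hl', h5, h6⟩
    refine ⟨hl, (h1 l hl).1 h3, fun l' h => ?_, ?_⟩
    · have hl'' : l' < (x.types j).length := h.1.trans_eq hZ
      refine (h4 l' hl'').resolve_left fun h' => ?_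
      rw [(h1 l' hl'').2 h] at h'
      cases h'
    · obtain ⟨_, h7⟩ := (h2 l' hl').1 h5
      rw [List.getD_eq_getElem _ _ hl', List.getD_eq_getElem _ _ hl, ← h7,
        ← Nat.mem_bitIndices] at h6
      exact h6
  · rintro ⟨hl, h3, h4, h5⟩
    refine ⟨hl, ⟨(h1 l hl).2 h3, fun l' hl' => ?_⟩, ?_⟩
    · rw [← Bool.not_eq_true, h1 l' hl', ← imp_iff_not_or]
      exact h4 l'
    · obtain ⟨l', hl', h'⟩ := List.getElem_of_mem
        ((Finset.mem_sort (· ≤ ·)).2 (Th_mem_possTh_map σ.Phi k (j + 1) Q b[0]))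
      simp only [← hT] at hl' h'
      refine ⟨l', hl', (h2 l' hl').2 ⟨hl', h'.symm⟩, ?_⟩
      rw [List.getD_eq_getElem _ _ hl', List.getD_eq_getElem _ _ hl, h', ← Nat.mem_bitIndices]
      exact h5

/-- An index in the cell of a theory `t` that is an element of its level-`(j+1)` theory has, by
definition, sets of its own summand producing `t`. These choices in different summands do not
interact, so they combine into families. -/
theorem valid_iff (hX : X.length = (Param.mk σ.data n m k).offset (j + 1)) (hj : j + 1 ≤ n)
    (hQ : Q.length + setSum k (j + 1) = m + setSum k n) (hr : 1 ≤ seq r 0)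
    (hZ : Z.length = ((Param.mk σ.data n m k).types j).length) :
    (Param.mk σ.data n m k).valid j
        (Th σ.Psi r j (X ++ thSets σ.Phi k (j + 1) Q ++ Z)) = true ↔
      ∃ W : List (∀ i, Set (M i)), W.length = seq k (j + 1) ∧ Z = thSets σ.Phi k j (Q ++ W) := by
  obtain ⟨W', hW'⟩ := exists_mem_bitIndices_pick σ.Psi r j (X ++ thSets σ.Phi k (j + 1) Q ++ Z)
  have hT : (Param.mk σ.data n m k).types j =
      (possTh σ.Phi k j (Q.length + seq k (j + 1))).sort (· ≤ ·) := by
    refine types_mk ?_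
    rw [setSum_succ] at hQ
    omega
  have h1 : (Param.mk σ.data n m k).valid j
        (Th σ.Psi r j (X ++ thSets σ.Phi k (j + 1) Q ++ Z)) = true ↔
      ∀ i : N, ∃ l, ∃ hl : l < ((Param.mk σ.data n m k).types j).length,
        MemAt Z l i ∧ (∀ l', MemAt Z l' i → l' = l) ∧
        ((Param.mk σ.data n m k).types j)[l] ∈
          (Th σ.Phi k (j + 1) (Q.map fun Q => Q i)).bitIndices := by
    rw [valid, List.all_eq_true]
    constructor
    · intro h i
      -- The constant tuple brings the index `i` to position 0, so every index gets tested.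
      have h2 := h _ ((hW' _).2 ⟨List.replicate (seq r 0) i, List.length_replicate, rfl⟩)
      rw [validAt_iff hX hj hQ hZ (by rwa [List.length_replicate])] at h2
      have hlt : 0 < (List.replicate (seq r 0) i).length := by rwa [List.length_replicate]
      generalize hi : (List.replicate (seq r 0) i)[0]'hlt = i' at h2
      rw [List.getElem_replicate] at hi
      subst hi
      exact h2
    · intro h u hu
      obtain ⟨b, hb, rfl⟩ := (hW' u).1 hu
      rw [validAt_iff hX hj hQ hZ (by omega)]
      exact h _
  rw [h1]
  constructor
  · intro h
    choose l hl h2 h3 h4 using h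
    have h5 : ∀ i, ∃ W : List (Set (M i)), W.length = seq k (j + 1) ∧
        ((Param.mk σ.data n m k).types j)[l i]'(hl i) =
          Th σ.Phi k j ((Q.map fun Q => Q i) ++ W) := fun i => mem_bitIndices_Th_succ.1 (h4 i)
    choose W hW h6 using h5
    -- The coordinates of the separately chosen sequences are assembled into families.
    let V : List (∀ i, Set (M i)) := List.ofFn fun (e : Fin (seq k (j + 1))) i =>
      (W i)[e]'(e.2.trans_eq (hW i).symm)
    have hV : ∀ i, (Q ++ V).map (fun Q => Q i) = (Q.map fun Q => Q i) ++ W i := by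
      intro i
      rw [List.map_append]
      congr 1
      apply List.ext_getElem <;> simp [V, hW]
    have hVl : V.length = seq k (j + 1) := List.length_ofFn
    refine ⟨V, hVl, ?_⟩
    apply List.ext_getElem
    · rw [thSets, length_typeSets, List.length_append, hVl, ← hT, hZ]
    · intro s hs hs'
      ext i
      have h7 : i ∈ (thSets σ.Phi k j (Q ++ V))[s] ↔ MemAt (thSets σ.Phi k j (Q ++ V)) s i :=
        ⟨fun h => ⟨hs', h⟩, fun h => h.2⟩
      have h8 : i ∈ Z[s] ↔ MemAt Z s i := ⟨fun h => ⟨hs, h⟩, fun h => h.2⟩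
      rw [h7, h8, thSets, memAt_typeSets]
      simp only [hV, List.length_append, hVl, ← hT, ← h6]
      constructor
      · intro h
        obtain rfl := h3 i s h
        exact ⟨hl i, rfl⟩
      · rintro ⟨h, h'⟩
        -- The possible theories are listed without repetition, so a theory determines its cell.
        have hnd : ((Param.mk σ.data n m k).types j).Nodup := Nat.bitIndices_nodup
        rw [← (hnd.getElem_inj_iff).1 h']
        exact h2 i
  · rintro ⟨W, hW, rfl⟩ i
    have hp : (Q ++ W).length = Q.length + seq k (j + 1) := by rw [List.length_append, hW]
    obtain ⟨l, hl, h⟩ := List.getElem_of_mem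
      ((Finset.mem_sort (· ≤ ·)).2 (Th_mem_possTh_map σ.Phi k j (Q ++ W) i))
    simp only [hp, ← hT] at hl h
    have h2 : ∀ l', MemAt (thSets σ.Phi k j (Q ++ W)) l' i ↔
        ∃ h : l' < ((Param.mk σ.data n m k).types j).length,
          Th σ.Phi k j ((Q ++ W).map fun Q => Q i) = ((Param.mk σ.data n m k).types j)[l'] := by
      intro l'
      rw [thSets, memAt_typeSets]
      simp only [hp, hT]
    refine ⟨l, hl, (h2 l).2 ⟨hl, h.symm⟩, fun l' h' => ?_, ?_⟩
    · obtain ⟨h3, h4⟩ := (h2 l').1 h'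
      have hnd : ((Param.mk σ.data n m k).types j).Nodup := Nat.bitIndices_nodup
      exact (hnd.getElem_inj_iff).1 (h4.symm.trans h.symm)
    · rw [h, List.map_append, mem_bitIndices_Th_succ]
      exact ⟨_, by rw [List.length_map, hW], rfl⟩

/-- The list `X` is general because each step turns the type sets just used into part of the prefix.
The balance `hQ` of present and future sets keeps the parameters, and thus the lists of possible
theories, the same at all levels. -/
theorem sumTh_eq (hX : X.length = (Param.mk σ.data n m k).offset j) (hj : j ≤ n)
    (hQ : Q.length + setSum k j = m + setSum k n) (hk : 1 ≤ seq k 0) (hr : seq k 0 ≤ seq r 0)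
    (hr' : ∀ i < n, seq r (i + 1) = ((Param.mk σ.data n m k).types i).length) :
    (Param.mk σ.data n m k).sumTh (m + setSum k n) j
        (Th σ.Psi r j (X ++ thSets σ.Phi k j Q)) =
      letI := σ.sumStructure N M
      Th (atomic σ.L₃) k j (unionSets Q) := by
  let := σ.sumStructure N M
  induction j generalizing X Q with
  | zero => exact sumTh0_eq hX hQ hk hr
  | succ j ih =>
    have hTh : Th (atomic σ.L₃) k (j + 1) (unionSets Q) = hf {c | ∃ S : List (Set (Σ i, M i)),
      S.length = seq k (j + 1) ∧ c = Th (atomic σ.L₃) k j (unionSets Q ++ S)} := rfl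
    have hY : (X ++ thSets σ.Phi k (j + 1) Q).length = (Param.mk σ.data n m k).offset j := by
      rw [List.length_append, hX, thSets, length_typeSets, ← types_mk hQ, ← offset_eq _ hj]
    have key : ∀ W : List (∀ i, Set (M i)), W.length = seq k (j + 1) →
        (Param.mk σ.data n m k).sumTh (m + setSum k n) j (Th σ.Psi r j
          (X ++ thSets σ.Phi k (j + 1) Q ++ thSets σ.Phi k j (Q ++ W))) =
        Th (atomic σ.L₃) k j (unionSets Q ++ unionSets W) := by
      intro W hW
      rw [← unionSets_append]
      refine ih hY (by omega) ?_
      rw [List.length_append, hW, ← hQ, setSum_succ]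
      omega
    rw [hTh, sumTh]
    refine mkCode_eq fun c => ?_
    simp only [List.mem_map, List.mem_filter, mem_bitIndices_Th_succ, Set.mem_ofPred_eq]
    constructor
    · rintro ⟨_, ⟨⟨Z, hZ, rfl⟩, h⟩, rfl⟩
      rw [hr' j hj] at hZ
      obtain ⟨W, hW, rfl⟩ := (valid_iff hX hj hQ (hk.trans hr) hZ).1 h
      exact ⟨unionSets W, (List.length_map _).trans hW, key W hW⟩
    · rintro ⟨S, hS, rfl⟩
      obtain ⟨W, hW, rfl⟩ := exists_unionSets_eq S
      have hZ : (thSets σ.Phi k j (Q ++ W)).length =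
          ((Param.mk σ.data n m k).types j).length := by
        rw [thSets, length_typeSets, ← types_mk]
        rw [List.length_append, hW, hS, ← hQ, setSum_succ]
        omega
      exact ⟨_, ⟨⟨_, hZ.trans (hr' j hj).symm, rfl⟩,
        (valid_iff hX hj hQ (hk.trans hr) hZ).2 ⟨W, hW.trans hS, rfl⟩⟩, key W (hW.trans hS)⟩

end

end Param

/-! ### Admissibility of `r̄` and the general theorem -/

theorem one_le_seq {L : FinLang} {k : List ℕ} (hk : Admissible L k) (i : ℕ) : 1 ≤ seq k i := by
  rw [seq]
  by_cases h : i < k.length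
  · rw [List.getD_eq_getElem _ _ h]
    exact hk.1 _ (List.getElem_mem h)
  · rw [List.getD_eq_default _ _ (by omega)]

theorem le_foldr_add {l : List ℕ} {a : ℕ} (h : a ∈ l) : a ≤ l.foldr (fun a b => a + b) 0 := by
  induction l with
  | nil => cases h
  | cons b l ih =>
    rw [List.foldr_cons]
    rcases List.mem_cons.1 h with rfl | h
    · omega
    · have := ih h
      omega

theorem Rule.rSeq_eq (σ : Rule) (n m : ℕ) (k : List ℕ) : rSeq (σ.code, n, m, k) =
    (seq k 0 + σ.L₂.rels.foldr (fun a b => a + b) 0) ::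
      (List.range n).map fun j => ((Param.mk σ.data n m k).types j).length := by
  rw [rSeq, Rule.ofNat_code]
  rfl

/-- The possible theories form a power set, which contains the empty set, coded by `0`. This makes
the entries of `r̄` at least 1. -/
theorem Param.length_types_pos (x : Param) (j : ℕ) : 1 ≤ (x.types j).length := by
  have h : 0 ∈ x.types j := by
    rw [Param.types, powIter_succ, powCode, mem_bitIndices_mkCode]
    simp
  exact List.length_pos_of_mem h

/-- The first entry adds the sum of all arities of `L₂` to `k̄(0)`: it bounds every arity and leaves
room for the tuples of length `k̄(0)`. -/
theorem Rule.rSeq_admissible (σ : Rule) (n m : ℕ) {k : List ℕ}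
    (hk : Admissible (relLang σ.L₃) k) : Admissible σ.L₂ (rSeq (σ.code, n, m, k)) := by
  rw [Rule.rSeq_eq]
  constructor
  · intro a ha
    rcases List.mem_cons.1 ha with rfl | ha
    · exact (one_le_seq hk 0).trans (Nat.le_add_right _ _)
    · obtain ⟨j, -, rfl⟩ := List.mem_map.1 ha
      exact Param.length_types_pos _ _
  · exact fun a ha => (le_foldr_add ha).trans (Nat.le_add_left _ _)

theorem Rule.sumFun_eq (σ : Rule) (n m : ℕ) {k : List ℕ} (hk : Admissible (relLang σ.L₃) k)
    {N : Type u} [σ.L₂.lang.Structure N] {M : N → Type v} [∀ i, σ.L₁.lang.Structure (M i)]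
    (P : ∀ i, Fin m → Set (M i)) :
    sumFun (σ.code, n, m, k, Th σ.Psi (rSeq (σ.code, n, m, k)) n
      (typeSets (possTh σ.Phi k n m) fun i => Th σ.Phi k n (List.ofFn (P i)))) =
      σ.sumTh n k P := by
  let Q : List (∀ i, Set (M i)) := List.ofFn fun l i => P i l
  have hQl : Q.length = m := List.length_ofFn
  have h1 : typeSets (possTh σ.Phi k n m) (fun i => Th σ.Phi k n (List.ofFn (P i))) =
      [] ++ thSets σ.Phi k n Q := by
    rw [List.nil_append, thSets, hQl]
    congr 1
    funext i
    rw [List.map_ofFn]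
    rfl
  have h2 : List.ofFn (fun l => {x : Σ i, M i | x.2 ∈ P x.1 l}) = unionSets Q := by
    rw [unionSets, List.map_ofFn]
    rfl
  rw [Rule.sumTh, h2, sumFun, Rule.ofNat_code, h1]
  -- At the top level nothing precedes the type sets: the prefix is empty and the offset is `0`.
  refine Param.sumTh_eq (Param.offset_self _).symm le_rfl (by rw [hQl]) (one_le_seq hk 0) ?_ ?_
  · rw [Rule.rSeq_eq]
    exact Nat.le_add_right _ _
  · intro i hi
    rw [Rule.rSeq_eq]
    simp [seq, hi]

/-! ### Ordered sums of linear orders -/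

/-- The formula `x_0 < x_1`. -/
def ltInst : Inst (relLang ordArity) 2 :=
  ⟨2, Relations.formula (relSymb (A := ordArity) (0 : Fin 1)) fun j => var j, id⟩

/-- The condition that `x_0 < x_1` in one of the summands. -/
def ltInner : Cond (relLang ordArity) (relLang ordArity) 2 where
  E := ⊤
  Φ := {ltInst}
  Ψ := ∅
  pos f hf := by
    rw [Finset.mem_singleton.1 hf]
    exact two_pos
  equiv _ _ _ _ := trivial

/-- The condition that `x_0` belongs to an earlier summand than `x_1`. -/
def ltOuter : Cond (relLang ordArity) (relLang ordArity) 2 where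
  E := ⊥
  Φ := ∅
  Ψ := {ltInst}
  pos f hf := absurd hf (Finset.notMem_empty f)
  equiv f hf := absurd hf (Finset.notMem_empty f)

/-- The rule of the ordered sum of linear orders. -/
noncomputable abbrev ordRule : Rule where
  L₁ := relLang ordArity
  L₂ := relLang ordArity
  L₃ := ordArity
  cond := open Classical in
    Fin.cases (n := 0) (motive := fun R => Finset (Cond _ _ (ordArity.get R)))
      ({ltInner, ltOuter} : Finset (Cond _ _ 2)) fun i => i.elim0

theorem mem_ordRule_cond {τ : Cond (relLang ordArity) (relLang ordArity) 2} :
    τ ∈ ordRule.cond (0 : Fin 1) ↔ τ = ltInner ∨ τ = ltOuter := by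
  classical
  refine (show τ ∈ ({ltInner, ltOuter} : Finset _) ↔ _ from ?_)
  simp only [Finset.mem_insert, Finset.mem_singleton]

/-- The only formula of `L₁` in the rule is `x_0 < x_1`, contributed by `ltInner`; with equality and
membership this exhausts the atomic formulas. -/
theorem ordRule_Phi : ordRule.Phi = atomic ordArity := by
  classical
  ext φ
  refine Iff.trans ?_ mem_atomic.symm
  rw [Rule.Phi]
  simp only [Finset.mem_union, Finset.mem_biUnion, Finset.mem_univ, true_and, Finset.mem_image,
    Finset.mem_insert, Finset.mem_singleton]
  refine or_congr ?_ Iff.rfl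
  constructor
  · rintro ⟨R, τ, hτ, f, hf, rfl⟩
    obtain rfl : R = (0 : Fin 1) := Subsingleton.elim (α := Fin 1) _ _
    rcases mem_ordRule_cond.1 hτ with rfl | rfl
    · rw [Finset.mem_singleton.1 hf]
      exact ⟨(0 : Fin 1), rfl⟩
    · exact absurd hf (Finset.notMem_empty f)
  · rintro ⟨i, rfl⟩
    obtain rfl : i = (0 : Fin 1) := Subsingleton.elim (α := Fin 1) _ _
    exact ⟨(0 : Fin 1), ltInner, mem_ordRule_cond.2 (Or.inl rfl), ltInst,
      Finset.mem_singleton_self _, rfl⟩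

theorem ordRule_Psi : ordRule.Psi = atomic ordArity := by
  classical
  ext φ
  refine Iff.trans ?_ mem_atomic.symm
  rw [Rule.Psi]
  simp only [Finset.mem_union, Finset.mem_biUnion, Finset.mem_univ, true_and, Finset.mem_image,
    Finset.mem_insert, Finset.mem_singleton]
  refine or_congr ?_ Iff.rfl
  constructor
  · rintro ⟨R, τ, hτ, f, hf, rfl⟩
    obtain rfl : R = (0 : Fin 1) := Subsingleton.elim (α := Fin 1) _ _
    rcases mem_ordRule_cond.1 hτ with rfl | rfl
    · exact absurd hf (Finset.notMem_empty f)
    · rw [Finset.mem_singleton.1 hf]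
      exact ⟨(0 : Fin 1), rfl⟩
  · rintro ⟨i, rfl⟩
    obtain rfl : i = (0 : Fin 1) := Subsingleton.elim (α := Fin 1) _ _
    exact ⟨(0 : Fin 1), ltOuter, mem_ordRule_cond.2 (Or.inr rfl), ltInst,
      Finset.mem_singleton_self _, rfl⟩

theorem ordStructure_relMap {α : Type u} [LinearOrder α] (x : Fin 2 → α) :
    @FirstOrder.Language.Structure.RelMap _ α (ordStructure α) 2 (relSymb (A := ordArity) (0 : Fin 1)) x ↔
      x 0 < x 1 := by
  refine (show (∃ a b, List.ofFn x = [a, b] ∧ a < b) ↔ _ from ?_)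
  have h : List.ofFn x = [x 0, x 1] := by simp [List.ofFn_succ]
  rw [h]
  constructor
  · rintro ⟨a, b, h1, h2⟩
    simp only [List.cons.injEq, and_true] at h1
    rwa [h1.1, h1.2]
  · exact fun h => ⟨_, _, rfl, h⟩

theorem realize_ltInst {α : Type u} [LinearOrder α] (x : Fin 2 → α) :
    @FirstOrder.Language.Formula.Realize _ α (ordStructure α) _ ltInst.form x ↔ x 0 < x 1 := by
  let := ordStructure α
  exact (Formula.realize_rel (L := (relLang ordArity).lang)).trans (ordStructure_relMap x)

/-- The two conditions are the two cases of the lexicographic order: same index and smaller second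
coordinate, or smaller index. -/
theorem ordRule_sumStructure (N : Type u) [LinearOrder N] (M : N → Type v)
    [∀ i, LinearOrder (M i)] :
    @Rule.sumStructure ordRule N (ordStructure N) M (fun i => ordStructure (M i)) =
      (ordStructure (Σₗ i, M i) : (relLang ordArity).lang.Structure (Σₗ i, M i)) := by
  let := ordStructure N
  let := fun i => ordStructure (M i)
  apply FirstOrder.Language.Structure.ext
  · funext n f
    exact f.1.elim0
  · funext n R x
    obtain ⟨R, rfl⟩ := R
    obtain rfl : R = (0 : Fin 1) := Subsingleton.elim (α := Fin 1) _ _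
    apply propext
    change Fin 2 → (Σ i, M i) at x
    refine Iff.trans (b := ltInner.Sat x ∨ ltOuter.Sat x) ?_
      (Iff.trans (b := toLex (x 0) < toLex (x 1)) ?_
        (ordStructure_relMap (α := Σₗ i, M i) x).symm)
    · refine (show (∃ τ ∈ ordRule.cond (0 : Fin 1), Cond.Sat τ x) ↔ _ from ?_)
      constructor
      · rintro ⟨τ, hτ, h⟩
        rcases mem_ordRule_cond.1 hτ with rfl | rfl
        exacts [Or.inl h, Or.inr h]
      · rintro (h | h)
        exacts [⟨_, mem_ordRule_cond.2 (Or.inl rfl), h⟩, ⟨_, mem_ordRule_cond.2 (Or.inr rfl), h⟩]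
    · have h1 : ltInner.Sat x ↔ (∀ l m, (x l).1 = (x m).1 ↔ True) ∧
          ∃ (i : N) (a : Fin 2 → M i), (∀ s, x s = ⟨i, a s⟩) ∧ a 0 < a 1 := by
        refine and_congr Iff.rfl ?_
        constructor
        · rintro ⟨h, -⟩
          obtain ⟨i, a, h1, h2⟩ := h _ (Finset.mem_singleton_self _)
          exact ⟨i, a, h1, (realize_ltInst a).1 h2⟩
        · rintro ⟨i, a, h1, h2⟩
          refine ⟨fun f hf => ?_, fun f hf => absurd hf (Finset.notMem_empty f)⟩
          cases Finset.mem_singleton.1 hf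
          exact ⟨i, a, h1, (realize_ltInst a).2 h2⟩
      have h2 : ltOuter.Sat x ↔ (∀ l m, (x l).1 = (x m).1 ↔ l = m) ∧ (x 0).1 < (x 1).1 := by
        refine and_congr Iff.rfl ?_
        constructor
        · rintro ⟨-, h⟩
          exact (realize_ltInst fun s => (x s).1).1 (h _ (Finset.mem_singleton_self _))
        · intro h
          refine ⟨fun f hf => absurd hf (Finset.notMem_empty f), fun f hf => ?_⟩
          cases Finset.mem_singleton.1 hf
          exact (realize_ltInst fun s => (x s).1).2 h
      rw [h1, h2]
      have h3 : toLex (x 0) < toLex (x 1) ↔ Sigma.Lex (· < ·) (fun _ => (· < ·)) (x 0) (x 1) :=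
        Iff.rfl
      rw [h3]
      constructor
      · rintro (⟨-, i, a, h, h'⟩ | ⟨-, h⟩)
        · rw [h, h]
          exact Sigma.Lex.right _ _ h'
        · exact Sigma.Lex.left _ _ h
      · intro h
        rw [Sigma.lex_iff] at h
        rcases h with h | ⟨h, h'⟩
        · refine Or.inr ⟨?_, h⟩
          intro l m
          fin_cases l <;> fin_cases m <;> simp [h.ne, h.ne']
        · left
          obtain ⟨y, hy⟩ : ∃ y, y = x := ⟨_, rfl⟩
          obtain ⟨⟨i, a⟩, h0⟩ : ∃ y, y = x 0 := ⟨_, rfl⟩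
          obtain ⟨⟨i', b⟩, h1⟩ : ∃ y, y = x 1 := ⟨_, rfl⟩
          -- With the two entries explicit, the equality of their indices can be eliminated by
          -- substitution, after which both elements lie in the same summand.
          have hx : x = ![⟨i, a⟩, ⟨i', b⟩] := by
            funext s
            fin_cases s
            exacts [h0.symm, h1.symm]
          subst hx
          obtain rfl : i = i' := h
          refine ⟨fun l m => ?_, i, ![a, b], fun s => ?_, h'⟩
          · fin_cases l <;> fin_cases m <;> simp
          · fin_cases s <;> rfl

theorem ordRule_sumTh (n : ℕ) (k : List ℕ) {m : ℕ} (N : Type u) [LinearOrder N] (M : N → Type v)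
    [∀ i, LinearOrder (M i)] (P : ∀ i, Fin m → Set (M i)) :
    @Rule.sumTh ordRule n k m N (ordStructure N) M (fun i => ordStructure (M i)) P =
      ordTh k n (List.ofFn fun l => {x : Σₗ i, M i | (ofLex x).2 ∈ P (ofLex x).1 l}) := by
  have h : ∀ s : (relLang ordArity).lang.Structure (Σₗ i, M i), s = ordStructure (Σₗ i, M i) →
      @Th (relLang ordArity) (Σₗ i, M i) s (atomic ordArity) k n
        (List.ofFn fun l => {x : Σₗ i, M i | (ofLex x).2 ∈ P (ofLex x).1 l}) =
      ordTh k n (List.ofFn fun l => {x : Σₗ i, M i | (ofLex x).2 ∈ P (ofLex x).1 l}) := by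
    rintro _ rfl
    rfl
  exact h _ (ordRule_sumStructure N M)

end MonadicSum

open MonadicSum in
theorem theorem2p4 :
    -- generalized sums
    (∃ (r : ℕ × ℕ × ℕ × List ℕ → List ℕ) (F : ℕ × ℕ × ℕ × List ℕ × ℕ → ℕ),
      Computable r ∧ Computable F ∧
      ∀ (σ : Rule) (n m : ℕ) (k : List ℕ), Admissible (relLang σ.L₃) k →
        Admissible σ.L₂ (r (σ.code, n, m, k)) ∧ n + 1 ≤ (r (σ.code, n, m, k)).length ∧
        ∀ (N : Type u) [σ.L₂.lang.Structure N] (M : N → Type v)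
          [∀ i, σ.L₁.lang.Structure (M i)] (P : ∀ i, Fin m → Set (M i)),
          F (σ.code, n, m, k,
              Th σ.Psi (r (σ.code, n, m, k)) n
                (typeSets (possTh σ.Phi k n m) fun i => Th σ.Phi k n (List.ofFn (P i))))
            = σ.sumTh n k P) ∧
    -- ordered sums of linear orders
    (∃ (r : ℕ × ℕ × List ℕ → List ℕ) (F : ℕ × ℕ × List ℕ × ℕ → ℕ),
      Computable r ∧ Computable F ∧
      ∀ (n m : ℕ) (k : List ℕ), Admissible (relLang ordArity) k →
        Admissible (relLang ordArity) (r (n, m, k)) ∧ n + 1 ≤ (r (n, m, k)).length ∧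
        ∀ (N : Type u) [LinearOrder N] (M : N → Type v) [∀ i, LinearOrder (M i)]
          (P : ∀ i, Fin m → Set (M i)),
          F (n, m, k,
              ordTh (r (n, m, k)) n
                (typeSets (possTh (atomic ordArity) k n m) fun i => ordTh k n (List.ofFn (P i))))
            = ordTh k n
                (List.ofFn fun l => {x : Σₗ i, M i | (ofLex x).2 ∈ P (ofLex x).1 l})) := by
  have hlen : ∀ (σ : Rule) (n m : ℕ) (k : List ℕ), n + 1 ≤ (rSeq (σ.code, n, m, k)).length := by
    intro σ n m k
    simp [Rule.rSeq_eq]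
  -- For orders the rule is fixed, so its code is a constant input and computability is preserved.
  refine ⟨⟨rSeq, sumFun, primrec_rSeq.to_comp, primrec_sumFun.to_comp, fun σ n m k hk =>
    ⟨σ.rSeq_admissible n m hk, hlen σ n m k, fun N _ M _ P => σ.sumFun_eq n m hk P⟩⟩,
    fun y => rSeq (ordRule.code, y), fun y => sumFun (ordRule.code, y),
    (primrec_rSeq.comp ((primrec_const _).pair primrec_id)).to_comp,
    (primrec_sumFun.comp ((primrec_const _).pair primrec_id)).to_comp, fun n m k hk =>
    ⟨ordRule.rSeq_admissible n m hk, hlen ordRule n m k, fun N _ M _ P => ?_⟩⟩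
  let := ordStructure N
  let := fun i => ordStructure (M i)
  have h := ordRule.sumFun_eq n m hk (N := N) (M := M) P
  rw [ordRule_Phi, ordRule_Psi] at h
  exact h.trans (ordRule_sumTh n k N M P)
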